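/- **Lemma (Cosh-power interpolation).** For an integer $d\ge 1$ let $$E=\{z\in\mathbb C:\ |\operatorname{Re}z|\le 2d\pi,\ |\operatorname{Im}z|\le 2d\pi\},\qquad R=\left(d-\tfrac13\right)\pi,\qquad D=\{z\in\mathbb C:\ |z|<R\},$$ and for $r>0$ let $$\mathcal E_r=\left\{z\in\mathbb C:\ \frac{(\operatorname{Re}z)^2}{(2\cosh r)^2}+\frac{(\operatorname{Im}z)^2}{(2\sinh r)^2}<1\right\}.$$ Recall that a map $G$ is $K$-quasiregular ($K\ge 1$) on an open set $U\subseteq\mathbb C$ if it is continuous on $U$, is absolutely continuous on lines in $U$ with partial derivatives in $L^2_{\mathrm{loc}}(U)$ (equivalently, $G$ is continuous and belongs to $W^{1,2}_{\mathrm{loc}}(U)$), and satisfies $|\partial_{\bar z}G|\le\frac{K-1}{K+1}\,|\partial_zG|$ almost everywhere in $U$. Its complex dilatation is $\mu_G=\partial_{\bar z}G/\partial_zG$ (with $\mu_G=0$ where $\partial_zG=0$), and $\operatorname{supp}\mu_G=\{z:\mu_G(z)\ne0\}$. A map $G$ on the closed square $E$ is called $K$-quasiregular if it is continuous on $E$ and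 $K$-quasiregular on the interior of $E$. There is a constant $K_1\ge1$ such that for every integer $d\ge1$ there is a $K_1$-quasiregular map $G:E\to\overline{\mathcal E}_{2d\pi}$ with $\operatorname{supp}\mu_G\subseteq E\setminus D$ such that $G(-z)=G(z)$ and $G(\bar z)=\overline{G(z)}$ for all $z\in E$, and $$G(z)=\begin{cases}2\cosh z, & z\in\partial E\cup\bigl((E\cap i\mathbb R)\setminus D\bigr),\\[4pt] \left(\dfrac zR\right)^{2d}, & z\in\overline D.\end{cases}$$ -/

import Mathlib

open MeasureTheory Set Complex

noncomputable section

/-- The partial derivative of `G` in the real direction at `z = x + iy`. -/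
def partialX (G : ℂ → ℂ) (z : ℂ) : ℂ :=
  deriv (fun t : ℝ => G (z + (t : ℂ))) 0

/-- The partial derivative of `G` in the imaginary direction at `z = x + iy`. -/
def partialY (G : ℂ → ℂ) (z : ℂ) : ℂ :=
  deriv (fun t : ℝ => G (z + (t : ℂ) * I)) 0

/-- The Wirtinger derivative `∂G/∂z = (∂G/∂x - i ∂G/∂y) / 2`. -/
def wirtingerZ (G : ℂ → ℂ) (z : ℂ) : ℂ :=
  (partialX G z - I * partialY G z) / 2

/-- The Wirtinger derivative `∂G/∂z̄ = (∂G/∂x + i ∂G/∂y) / 2`. -/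
def wirtingerZbar (G : ℂ → ℂ) (z : ℂ) : ℂ :=
  (partialX G z + I * partialY G z) / 2

/-- The complex dilatation (Beltrami coefficient) `μ_G = (∂G/∂z̄) / (∂G/∂z)`,
with the usual value `0` where `∂G/∂z` vanishes. -/
def beltramiCoeff (G : ℂ → ℂ) (z : ℂ) : ℂ :=
  wirtingerZbar G z / wirtingerZ G z

/-- `G` is absolutely continuous on lines (ACL) in `U`: in every closed rectangle
`[a, b] × [c, d]` contained in `U`, it is absolutely continuous on almost every horizontal
and on almost every vertical segment. -/
def IsACLOn (G : ℂ → ℂ) (U : Set ℂ) : Prop :=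
  ∀ a b c d : ℝ, a ≤ b → c ≤ d → Icc a b ×ℂ Icc c d ⊆ U →
    (∀ᵐ y : ℝ, y ∈ Icc c d →
      AbsolutelyContinuousOnInterval (fun x : ℝ => G ((x : ℂ) + (y : ℂ) * I)) a b) ∧
    (∀ᵐ x : ℝ, x ∈ Icc a b →
      AbsolutelyContinuousOnInterval (fun y : ℝ => G ((x : ℂ) + (y : ℂ) * I)) c d)

/-- `G` is `K`-quasiregular on the open set `U` (analytic definition): it is continuous, ACL with
locally square integrable partial derivatives (that is, a continuous function in the Sobolev
space `W^{1,2}_loc(U)`), and almost everywhere `|∂G/∂z̄| ≤ k |∂G/∂z|` with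
`k = (K - 1) / (K + 1)`, i.e. `|μ_G| ≤ k < 1`, i.e. `(1 + |μ_G|) / (1 - |μ_G|) ≤ K`. -/
structure IsQuasiregularOn (K : ℝ) (G : ℂ → ℂ) (U : Set ℂ) : Prop where
  one_le : 1 ≤ K
  isOpen : IsOpen U
  continuousOn : ContinuousOn G U
  acl : IsACLOn G U
  locallySqIntegrable_partialX : LocallyIntegrableOn (fun z => ‖partialX G z‖ ^ 2) U
  locallySqIntegrable_partialY : LocallyIntegrableOn (fun z => ‖partialY G z‖ ^ 2) U
  dilatation_le : ∀ᵐ z : ℂ, z ∈ U →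
    ‖wirtingerZbar G z‖ ≤ (K - 1) / (K + 1) * ‖wirtingerZ G z‖

/-- The closed square `{|Re z| ≤ 2dπ, |Im z| ≤ 2dπ}`. -/
def squareE (d : ℕ) : Set ℂ :=
  {z | |z.re| ≤ 2 * d * Real.pi ∧ |z.im| ≤ 2 * d * Real.pi}

/-- The radius `(d - 1/3)π`. -/
def radiusR (d : ℕ) : ℝ := ((d : ℝ) - 1 / 3) * Real.pi

/-- The open disc about `0` of radius `(d - 1/3)π`. -/
def discD (d : ℕ) : Set ℂ := Metric.ball 0 (radiusR d)

/-- The open elliptical region with semiaxes `2 cosh r` (real) and `2 sinh r` (imaginary). -/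
def ellipseE (r : ℝ) : Set ℂ :=
  {z | z.re ^ 2 / (2 * Real.cosh r) ^ 2 + z.im ^ 2 / (2 * Real.sinh r) ^ 2 < 1}

end

open Topology NNReal Filter

noncomputable section

/-! ### Locally Lipschitz functions -/

/-! Write R for the radius and L = 2dπ for the half side. By symmetry it suffices to build the map
on the closed first quadrant with real values on both axes. Outside the disc the quadrant is split
along a cut that leaves iR at 45°, Im z = R + Re z, up to the top side of the square, and then
follows that side.

Above the cut the map is exp z + η exp(-z). The coefficient η is 1 near the imaginary axis and on
the top side, and drops to 0 on the cut at Re z = 2. It varies only where Re z ≥ 1; there exp z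
dominates, and the derivative is a small perturbation of a complex linear map
(`exists_distortion_exp_add`).

Below the cut the map is exp Φ + ρ exp(-Φ). Here Φ equals 2d log(z/R) on the circle, z on the right
side, and on the cut the value forced by the upper map. Since R = dπ - π/3, on the sloping cut
exp(-2z) depends on Re z alone and not on d (`exp_mul_spiral`), so for Re z ≤ 2 the upper map is
there exp z times the universal factor `cutFactor`. Its logarithm is added to z, and raises the
height of Φ at iR from R to dπ, which matches (z/R)^(2d). The 45° slope makes exp(-2z) decay along
the cut with a phase that keeps Re Φ strictly increasing (`exists_hasDerivAt_cutLog`). Past Re z = 2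
the correction is gone and ρ restores exp(-Φ).

Uniformity in d: distortion is measured by squared Hilbert–Schmidt norm over determinant, which is
submultiplicative. Φ is a composite of three triangular changes of variables whose entries are
bounded because L/3 ≤ R ≤ L/2 (`exists_distortion_logMap`). The pieces glue to a locally Lipschitz
map, so the analytic requirements reduce to a distortion bound off null curves. -/

theorem LocallyLipschitz.contDiffAt_comp {α E F : Type*} [PseudoEMetricSpace α]
    [NormedAddCommGroup E] [NormedSpace ℝ E] [NormedAddCommGroup F] [NormedSpace ℝ F]
    {f : α → E} {g : E → F} (hf : LocallyLipschitz f) (hg : ∀ x, ContDiffAt ℝ 1 g (f x)) :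
    LocallyLipschitz (fun x => g (f x)) := by
  intro x
  obtain ⟨K, t, ht, hK⟩ := (hg x).exists_lipschitzOnWith
  obtain ⟨K', t', ht', hK'⟩ := hf x
  refine ⟨K * K', t' ∩ f ⁻¹' t, inter_mem ht' (hf.continuous.continuousAt ht), ?_⟩
  exact hK.comp (hK'.mono inter_subset_left) (fun y hy => hy.2)

theorem LocallyLipschitz.contDiff_comp {α E F : Type*} [PseudoEMetricSpace α]
    [NormedAddCommGroup E] [NormedSpace ℝ E] [NormedAddCommGroup F] [NormedSpace ℝ F]
    {f : α → E} {g : E → F} (hf : LocallyLipschitz f) (hg : ContDiff ℝ 1 g) :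
    LocallyLipschitz (fun x => g (f x)) :=
  hf.contDiffAt_comp fun _ => hg.contDiffAt

theorem LocallyLipschitz.mul_algebra {α A : Type*} [PseudoEMetricSpace α] [NormedRing A]
    [NormedAlgebra ℝ A] {f g : α → A} (hf : LocallyLipschitz f) (hg : LocallyLipschitz g) :
    LocallyLipschitz (fun x => f x * g x) :=
  (hf.prodMk hg).contDiff_comp (g := fun p : A × A => p.1 * p.2) (contDiff_fst.mul contDiff_snd)

theorem LocallyLipschitz.div_real {α : Type*} [PseudoEMetricSpace α]
    {f g : α → ℝ} (hf : LocallyLipschitz f) (hg : LocallyLipschitz g) (h0 : ∀ x, g x ≠ 0) :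
    LocallyLipschitz (fun x => f x / g x) :=
  (hf.prodMk hg).contDiffAt_comp (g := fun p : ℝ × ℝ => p.1 / p.2) fun x =>
    contDiffAt_fst.div contDiffAt_snd (h0 x)

theorem LocallyLipschitz.re {α : Type*} [PseudoEMetricSpace α] {f : α → ℂ}
    (hf : LocallyLipschitz f) : LocallyLipschitz (fun x => (f x).re) :=
  hf.contDiff_comp reCLM.contDiff

theorem LocallyLipschitz.im {α : Type*} [PseudoEMetricSpace α] {f : α → ℂ}
    (hf : LocallyLipschitz f) : LocallyLipschitz (fun x => (f x).im) :=
  hf.contDiff_comp imCLM.contDiff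

theorem LocallyLipschitz.conj {α : Type*} [PseudoEMetricSpace α] {f : α → ℂ}
    (hf : LocallyLipschitz f) : LocallyLipschitz (fun x => starRingEnd ℂ (f x)) :=
  hf.contDiff_comp conjCLE.contDiff

theorem LocallyLipschitz.ofReal {α : Type*} [PseudoEMetricSpace α] {f : α → ℝ}
    (hf : LocallyLipschitz f) : LocallyLipschitz (fun x => (f x : ℂ)) :=
  hf.contDiff_comp ofRealCLM.contDiff

theorem LocallyLipschitz.complexMk {α : Type*} [PseudoEMetricSpace α] {f g : α → ℝ}
    (hf : LocallyLipschitz f) (hg : LocallyLipschitz g) :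
    LocallyLipschitz (fun x => (⟨f x, g x⟩ : ℂ)) := by
  have h : (fun x => (⟨f x, g x⟩ : ℂ)) = fun x => (f x : ℂ) + (g x : ℂ) * I := by
    funext x; exact (mk_eq_add_mul_I _ _)
  rw [h]
  exact hf.ofReal.add (hg.ofReal.mul_algebra (.const I))

theorem LocallyLipschitz.cexp {α : Type*} [PseudoEMetricSpace α] {f : α → ℂ}
    (hf : LocallyLipschitz f) : LocallyLipschitz (fun x => Complex.exp (f x)) :=
  hf.contDiff_comp (Complex.contDiff_exp (𝕜 := ℝ))

theorem LocallyLipschitz.abs_real {α : Type*} [PseudoEMetricSpace α] {f : α → ℝ}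
    (hf : LocallyLipschitz f) : LocallyLipschitz (fun x => |f x|) :=
  LocallyLipschitz.comp (f := fun x : ℝ => |x|) (LipschitzWith.locallyLipschitz (K := 1)
    (LipschitzWith.of_dist_le_mul fun x y => by
      simpa [Real.dist_eq] using abs_abs_sub_abs_le x y)) hf

/-- Two Lipschitz functions that agree on the overlap of two closed sets glue, on a convex set, to
a Lipschitz function. -/
theorem LipschitzOnWith.union_of_convex {E F : Type*} [NormedAddCommGroup E] [NormedSpace ℝ E]
    [NormedAddCommGroup F] {f : E → F} {K : ℝ≥0} {s S T : Set E} (hs : Convex ℝ s)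
    (hS : IsClosed S) (hT : IsClosed T) (hST : s ⊆ S ∪ T)
    (h₁ : LipschitzOnWith K f (s ∩ S)) (h₂ : LipschitzOnWith K f (s ∩ T)) :
    LipschitzOnWith K f s := by
  have key : ∀ x ∈ s ∩ S, ∀ y ∈ s ∩ T, dist (f x) (f y) ≤ K * dist x y := by
    intro x hx y hy
    have hseg : segment ℝ x y ⊆ s := hs.segment_subset hx.1 hy.1
    -- The segment is connected and covered by S and T, so it contains a point of both; distances
    -- add along it.
    obtain ⟨c, hc, hcS, hcT⟩ := isPreconnected_closed_iff.1
      (convex_segment x y).isPreconnected S T hS hT (hseg.trans hST)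
      ⟨x, left_mem_segment ℝ x y, hx.2⟩ ⟨y, right_mem_segment ℝ x y, hy.2⟩
    calc dist (f x) (f y) ≤ dist (f x) (f c) + dist (f c) (f y) := dist_triangle _ _ _
      _ ≤ K * dist x c + K * dist c y :=
        add_le_add (h₁.dist_le_mul _ hx _ ⟨hseg hc, hcS⟩) (h₂.dist_le_mul _ ⟨hseg hc, hcT⟩ _ hy)
      _ = K * dist x y := by rw [← mul_add, dist_add_dist_of_mem_segment hc]
  refine LipschitzOnWith.of_dist_le_mul fun x hx y hy => ?_
  rcases hST hx with h | h <;> rcases hST hy with h' | h'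
  · exact h₁.dist_le_mul _ ⟨hx, h⟩ _ ⟨hy, h'⟩
  · exact key x ⟨hx, h⟩ y ⟨hy, h'⟩
  · rw [dist_comm, dist_comm x]; exact key y ⟨hy, h'⟩ x ⟨hx, h⟩
  · exact h₂.dist_le_mul _ ⟨hx, h⟩ _ ⟨hy, h'⟩

theorem LocallyLipschitz.glue {E F : Type*} [NormedAddCommGroup E] [NormedSpace ℝ E]
    [NormedAddCommGroup F] {f g₁ g₂ : E → F} {S T : Set E}
    (hS : IsClosed S) (hT : IsClosed T) (hST : ∀ x, x ∈ S ∪ T)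
    (hg₁ : LocallyLipschitz g₁) (hg₂ : LocallyLipschitz g₂)
    (h₁ : EqOn f g₁ S) (h₂ : EqOn f g₂ T) : LocallyLipschitz f := by
  intro x
  obtain ⟨K₁, t₁, ht₁, hK₁⟩ := hg₁ x
  obtain ⟨K₂, t₂, ht₂, hK₂⟩ := hg₂ x
  obtain ⟨ε, hε, hball⟩ := Metric.mem_nhds_iff.1 (inter_mem ht₁ ht₂)
  refine ⟨max K₁ K₂, Metric.ball x ε, Metric.ball_mem_nhds x hε, ?_⟩
  refine LipschitzOnWith.union_of_convex (convex_ball x ε) hS hT (fun y _ => hST y) ?_ ?_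
  · refine LipschitzOnWith.weaken (K := K₁) ?_ (le_max_left _ _)
    intro y hy z hz
    rw [h₁ hy.2, h₁ hz.2]
    exact hK₁ (hball hy.1).1 (hball hz.1).1
  · refine LipschitzOnWith.weaken (K := K₂) ?_ (le_max_right _ _)
    intro y hy z hz
    rw [h₂ hy.2, h₂ hz.2]
    exact hK₂ (hball hy.1).2 (hball hz.1).2

theorem LocallyLipschitz.exists_lipschitzOnWith_Icc {F : Type*} [NormedAddCommGroup F]
    {f : ℝ → F} (hf : LocallyLipschitz f) (a b : ℝ) : ∃ K, LipschitzOnWith K f (uIcc a b) :=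
  (hf.locallyLipschitzOn).exists_lipschitzOnWith_of_compact isCompact_uIcc

theorem LocallyLipschitz.isACLOn {G : ℂ → ℂ} (hG : LocallyLipschitz G) (U : Set ℂ) :
    IsACLOn G U := by
  intro a b c d _ _ _
  refine ⟨.of_forall fun y _ => ?_, .of_forall fun x _ => ?_⟩
  · have h : LocallyLipschitz fun x : ℝ => G ((x : ℂ) + (y : ℂ) * I) :=
      hG.comp ((LocallyLipschitz.id (α := ℝ)).ofReal.add (.const _))
    obtain ⟨K, hK⟩ := h.exists_lipschitzOnWith_Icc a b
    exact hK.absolutelyContinuousOnInterval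
  · have h : LocallyLipschitz fun y : ℝ => G ((x : ℂ) + (y : ℂ) * I) :=
      hG.comp ((LocallyLipschitz.const (x : ℂ)).add
        ((LocallyLipschitz.id (α := ℝ)).ofReal.mul_algebra (.const I)))
    obtain ⟨K, hK⟩ := h.exists_lipschitzOnWith_Icc c d
    exact hK.absolutelyContinuousOnInterval

/-- Near each point the derivative is bounded by the local Lipschitz constant times ‖v‖. The cases v
= 1 and v = I are the two partial derivatives. -/
theorem LocallyLipschitz.locallyIntegrable_lineDeriv_sq {G : ℂ → ℂ} (hG : LocallyLipschitz G)
    (v : ℂ) : LocallyIntegrable (fun z => ‖deriv (fun t : ℝ => G (z + (t : ℂ) * v)) 0‖ ^ 2) := by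
  have hmeas : Measurable fun z => ‖deriv (fun t : ℝ => G (z + (t : ℂ) * v)) 0‖ ^ 2 := by
    have h := measurable_deriv_with_param (𝕜 := ℝ) (f := fun (z : ℂ) (t : ℝ) => G (z + (t : ℂ) * v))
      (by
        have := hG.continuous
        unfold Function.uncurry
        fun_prop)
    exact ((h.comp (measurable_id.prodMk measurable_const)).norm).pow_const 2
  intro x
  obtain ⟨K, t, ht, hK⟩ := hG x
  obtain ⟨ε, hε, hball⟩ := Metric.mem_nhds_iff.1 ht
  refine ⟨Metric.ball x ε, Metric.ball_mem_nhds x hε, ?_⟩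
  refine IntegrableOn.of_bound (C := ((K * ‖v‖) ^ 2 : ℝ)) measure_ball_lt_top
    hmeas.aestronglyMeasurable ?_
  refine (ae_restrict_iff' Metric.isOpen_ball.measurableSet).2 (.of_forall fun z hz => ?_)
  have hb : ‖deriv (fun t : ℝ => G (z + (t : ℂ) * v)) 0‖ ≤ K * ‖v‖ := by
    refine norm_deriv_le_of_lip' (by positivity) ?_
    have hc : ContinuousAt (fun t : ℝ => z + (t : ℂ) * v) 0 := by fun_prop
    have : ∀ᶠ t : ℝ in 𝓝 0, z + (t : ℂ) * v ∈ Metric.ball x ε :=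
      hc (Metric.isOpen_ball.mem_nhds (by simpa using hz))
    filter_upwards [this] with s hs
    have := hK.dist_le_mul _ (hball hs) _ (hball hz)
    simp only [dist_eq_norm] at this
    simpa [mul_assoc, mul_comm, mul_left_comm] using this
  rw [Real.norm_of_nonneg (by positivity)]
  gcongr

/-! ### Distortion of real linear maps of the plane -/

/-- The determinant of a real linear map of the plane. -/
def planeDet (L : ℂ →L[ℝ] ℂ) : ℝ := (L 1).re * (L I).im - (L 1).im * (L I).re

/-- A real linear map of the plane has distortion at most `C` if its squared Hilbert–Schmidt norm
is at most `C` times its determinant. -/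
def HasDistortionLE (C : ℝ) (L : ℂ →L[ℝ] ℂ) : Prop := ‖L 1‖ ^ 2 + ‖L I‖ ^ 2 ≤ C * planeDet L

theorem Complex.sq_norm_eq (z : ℂ) : ‖z‖ ^ 2 = z.re ^ 2 + z.im ^ 2 := by
  rw [Complex.sq_norm, normSq_apply]; ring

theorem apply_eq_re_im (L : ℂ →L[ℝ] ℂ) (z : ℂ) :
    L z = (⟨z.re * (L 1).re + z.im * (L I).re, z.re * (L 1).im + z.im * (L I).im⟩ : ℂ) := by
  have h : z = z.re • (1 : ℂ) + z.im • I := by simp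
  conv_lhs => rw [h, map_add, map_smul, map_smul]
  apply Complex.ext <;> simp

theorem planeDet_comp (L M : ℂ →L[ℝ] ℂ) : planeDet (L.comp M) = planeDet L * planeDet M := by
  simp only [planeDet, ContinuousLinearMap.comp_apply]
  rw [apply_eq_re_im L (M 1), apply_eq_re_im L (M I)]
  ring

/-- The Hilbert–Schmidt norm is submultiplicative and the determinant multiplicative. -/
theorem HasDistortionLE.comp {C C' : ℝ} {L M : ℂ →L[ℝ] ℂ} (hL : HasDistortionLE C L)
    (hM : HasDistortionLE C' M) : HasDistortionLE (C * C') (L.comp M) := by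
  unfold HasDistortionLE at *
  rw [planeDet_comp]
  have h1 : ‖L (M 1)‖ ^ 2 + ‖L (M I)‖ ^ 2 ≤
      (‖L 1‖ ^ 2 + ‖L I‖ ^ 2) * (‖M 1‖ ^ 2 + ‖M I‖ ^ 2) := by
    rw [apply_eq_re_im L (M 1), apply_eq_re_im L (M I)]
    simp only [Complex.sq_norm_eq]
    nlinarith [sq_nonneg ((M 1).re * (L I).re - (M 1).im * (L 1).re),
      sq_nonneg ((M 1).re * (L I).im - (M 1).im * (L 1).im),
      sq_nonneg ((M I).re * (L I).re - (M I).im * (L 1).re),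
      sq_nonneg ((M I).re * (L I).im - (M I).im * (L 1).im)]
  calc _ ≤ (‖L 1‖ ^ 2 + ‖L I‖ ^ 2) * (‖M 1‖ ^ 2 + ‖M I‖ ^ 2) := h1
    _ ≤ (C * planeDet L) * (C' * planeDet M) := by
      refine mul_le_mul hL hM (by positivity) ?_
      exact le_trans (by positivity) hL
    _ = _ := by ring

theorem HasDistortionLE.mono {C C' : ℝ} {L : ℂ →L[ℝ] ℂ} (hL : HasDistortionLE C L)
    (hC : 0 < C) (h : C ≤ C') : HasDistortionLE C' L := by
  unfold HasDistortionLE at *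
  have : 0 ≤ planeDet L := by
    by_contra hn
    have := mul_neg_of_pos_of_neg hC (not_le.1 hn)
    have : 0 ≤ ‖L 1‖ ^ 2 + ‖L I‖ ^ 2 := by positivity
    linarith
  exact hL.trans (mul_le_mul_of_nonneg_right h this)

/-- A perturbation of a complex linear map by a small real linear map has small distortion. -/
theorem HasDistortionLE.of_near_complexLinear {L : ℂ →L[ℝ] ℂ} {a : ℂ} {r : ℝ}
    (hr : 5 * r ≤ ‖a‖) (h1 : ‖L 1 - a‖ ≤ r) (hI : ‖L I - a * I‖ ≤ r) :
    HasDistortionLE 8 L := by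
  obtain ⟨e, he⟩ : ∃ e, e = L 1 - a := ⟨_, rfl⟩
  obtain ⟨f, hf⟩ : ∃ f, f = L I - a * I := ⟨_, rfl⟩
  rw [← he] at h1
  rw [← hf] at hI
  have hL1 : L 1 = a + e := by rw [he]; ring
  have hLI : L I = a * I + f := by rw [hf]; ring
  have hr0 : 0 ≤ r := (norm_nonneg _).trans h1
  have ha : 25 * r ^ 2 ≤ a.re ^ 2 + a.im ^ 2 := by
    rw [← Complex.sq_norm_eq]; nlinarith
  have he2 : e.re ^ 2 + e.im ^ 2 ≤ r ^ 2 := by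
    rw [← Complex.sq_norm_eq]; gcongr
  have hf2 : f.re ^ 2 + f.im ^ 2 ≤ r ^ 2 := by
    rw [← Complex.sq_norm_eq]; gcongr
  unfold HasDistortionLE planeDet
  rw [Complex.sq_norm_eq, Complex.sq_norm_eq, hL1, hLI]
  simp only [add_re, add_im, mul_re, mul_im, I_re, I_im]
  -- As |e|, |f| ≤ |a|/5, the left side is at most 2(6/5)²|a|² and the determinant at least (1 - 2/5
  -- - 1/25)|a|².
  nlinarith [sq_nonneg (a.re + 5 * e.re), sq_nonneg (a.im + 5 * e.im),
    sq_nonneg (a.re + 5 * f.im), sq_nonneg (a.im - 5 * f.re),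
    sq_nonneg (a.re - 5 * e.re), sq_nonneg (a.im - 5 * e.im),
    sq_nonneg (a.re - 5 * f.im), sq_nonneg (a.im + 5 * f.re),
    sq_nonneg (e.re + f.im), sq_nonneg (e.im - f.re)]

/-- A real linear map with bounded entries that is lower triangular, with diagonal entries bounded
below, has bounded distortion. -/
theorem HasDistortionLE.of_triangular {L : ℂ →L[ℝ] ℂ} {δ M : ℝ} (hδ : 0 < δ)
    (h1 : δ ≤ (L 1).re) (h1M : (L 1).re ≤ M) (h2 : δ ≤ (L I).im) (h2M : (L I).im ≤ M)
    (h : ((L 1).im = 0 ∧ |(L I).re| ≤ M) ∨ ((L I).re = 0 ∧ |(L 1).im| ≤ M)) :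
    HasDistortionLE (3 * M ^ 2 / δ ^ 2) L := by
  have key : ∀ a b e : ℝ, δ ≤ a → a ≤ M → δ ≤ e → e ≤ M → |b| ≤ M →
      a ^ 2 + b ^ 2 + e ^ 2 ≤ 3 * M ^ 2 / δ ^ 2 * (a * e) := by
    intro a b e ha haM he heM hb
    have hb2 : b ^ 2 ≤ M ^ 2 := sq_le_sq' (neg_le_of_abs_le hb) (le_of_abs_le hb)
    have hae : δ ^ 2 ≤ a * e := by nlinarith
    have : 3 * M ^ 2 ≤ 3 * M ^ 2 / δ ^ 2 * (a * e) := by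
      rw [div_mul_eq_mul_div, le_div_iff₀ (by positivity)]
      exact mul_le_mul_of_nonneg_left hae (by positivity)
    nlinarith
  unfold HasDistortionLE planeDet
  rw [Complex.sq_norm_eq, Complex.sq_norm_eq]
  rcases h with ⟨h, hb⟩ | ⟨h, hb⟩
  · have := key _ _ _ h1 h1M h2 h2M hb
    rw [h]; linarith
  · have := key _ _ _ h1 h1M h2 h2M hb
    rw [h]; linarith

theorem hasDistortionLE_of_complexLinear {L : ℂ →L[ℝ] ℂ} {a : ℂ} (hL : ∀ v, L v = a * v) :
    HasDistortionLE 2 L := by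
  unfold HasDistortionLE planeDet
  rw [Complex.sq_norm_eq, Complex.sq_norm_eq, hL, hL]
  simp
  nlinarith

theorem HasDistortionLE.reflect {C : ℝ} {L L' : ℂ →L[ℝ] ℂ} (hL : HasDistortionLE C L)
    (hL' : ∀ v, L' v = starRingEnd ℂ (L (starRingEnd ℂ v))) : HasDistortionLE C L' := by
  unfold HasDistortionLE planeDet at *
  rw [hL', hL', conj_I, map_neg]
  simp only [map_one, Complex.norm_conj, norm_neg, map_neg, neg_re, neg_im, conj_re, conj_im]
  linarith

theorem HasDistortionLE.neg_arg {C : ℝ} {L L' : ℂ →L[ℝ] ℂ} (hL : HasDistortionLE C L)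
    (hL' : ∀ v, L' v = L (-v)) : HasDistortionLE C L' := by
  unfold HasDistortionLE planeDet at *
  rw [hL', hL', map_neg, map_neg]
  simp only [norm_neg, neg_re, neg_im]
  linarith

/-! ### Quasiregularity from almost everywhere distortion bounds -/

theorem HasFDerivAt.partialX_eq {G : ℂ → ℂ} {z : ℂ} {L : ℂ →L[ℝ] ℂ} (h : HasFDerivAt G L z) :
    partialX G z = L 1 := by
  have h1 : HasDerivAt (fun t : ℝ => z + (t : ℂ)) 1 0 := by
    simpa using (ofRealCLM.hasDerivAt (x := (0 : ℝ))).const_add z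
  have h2 : HasFDerivAt G L (z + ((0 : ℝ) : ℂ)) := by simpa using h
  exact (h2.comp_hasDerivAt (0 : ℝ) h1).deriv

theorem HasFDerivAt.partialY_eq {G : ℂ → ℂ} {z : ℂ} {L : ℂ →L[ℝ] ℂ} (h : HasFDerivAt G L z) :
    partialY G z = L I := by
  have h1 : HasDerivAt (fun t : ℝ => z + (t : ℂ) * I) I 0 := by
    simpa using ((ofRealCLM.hasDerivAt (x := (0 : ℝ))).mul_const I).const_add z
  have h2 : HasFDerivAt G L (z + ((0 : ℝ) : ℂ) * I) := by simpa using h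
  exact (h2.comp_hasDerivAt (0 : ℝ) h1).deriv

/-- With p = |∂G| and q = |∂̄G|, the hypothesis reads 2(p² + q²) ≤ C(p² - q²), so q²(C + 2) ≤ p²(C -
2). Since (C - 2)/(C + 2) ≤ ((C - 1)/(C + 1))², the constant C itself serves as K. -/
theorem HasDistortionLE.wirtinger_le {G : ℂ → ℂ} {z : ℂ} {L : ℂ →L[ℝ] ℂ} {C : ℝ} (hC : 2 ≤ C)
    (h : HasFDerivAt G L z) (hL : HasDistortionLE C L) :
    ‖wirtingerZbar G z‖ ≤ (C - 1) / (C + 1) * ‖wirtingerZ G z‖ := by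
  have e1 : ‖wirtingerZ G z‖ ^ 2 + ‖wirtingerZbar G z‖ ^ 2 = (‖L 1‖ ^ 2 + ‖L I‖ ^ 2) / 2 := by
    simp only [wirtingerZ, wirtingerZbar, h.partialX_eq, h.partialY_eq, norm_div, div_pow]
    simp only [Complex.sq_norm_eq]
    simp
    ring
  have e2 : ‖wirtingerZ G z‖ ^ 2 - ‖wirtingerZbar G z‖ ^ 2 = planeDet L := by
    simp only [wirtingerZ, wirtingerZbar, h.partialX_eq, h.partialY_eq, norm_div, div_pow, planeDet]
    simp only [Complex.sq_norm_eq]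
    simp
    ring
  unfold HasDistortionLE at hL
  rw [← e2] at hL
  set p := ‖wirtingerZ G z‖
  set q := ‖wirtingerZbar G z‖
  have hp : 0 ≤ p := norm_nonneg _
  have hq : 0 ≤ q := norm_nonneg _
  have h3 : q ^ 2 * (C + 2) ≤ p ^ 2 * (C - 2) := by nlinarith
  rw [div_mul_eq_mul_div, le_div_iff₀ (by linarith)]
  have h4 : (q * (C + 1)) ^ 2 ≤ ((C - 1) * p) ^ 2 := by
    have h5 : (q * (C + 1)) ^ 2 * (C + 2) ≤ ((C - 1) * p) ^ 2 * (C + 2) := by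
      nlinarith [mul_le_mul_of_nonneg_right h3 (sq_nonneg (C + 1)), sq_nonneg p]
    exact le_of_mul_le_mul_right h5 (by linarith)
  exact (pow_le_pow_iff_left₀ (by positivity) (mul_nonneg (by linarith) hp) two_ne_zero).1 h4

theorem isQuasiregularOn_of_locallyLipschitz {G : ℂ → ℂ} {U : Set ℂ} {C : ℝ} (hC : 2 ≤ C)
    (hU : IsOpen U) (hG : LocallyLipschitz G)
    (h : ∀ᵐ z : ℂ, z ∈ U → ∃ L : ℂ →L[ℝ] ℂ, HasFDerivAt G L z ∧ HasDistortionLE C L) :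
    IsQuasiregularOn C G U where
  one_le := by linarith
  isOpen := hU
  continuousOn := hG.continuous.continuousOn
  acl := hG.isACLOn U
  locallySqIntegrable_partialX := by
    have := (hG.locallyIntegrable_lineDeriv_sq 1).locallyIntegrableOn U
    simpa [partialX] using this
  locallySqIntegrable_partialY := (hG.locallyIntegrable_lineDeriv_sq I).locallyIntegrableOn U
  dilatation_le := by
    filter_upwards [h] with z hz hzU
    obtain ⟨L, hL, hd⟩ := hz hzU
    exact hd.wirtinger_le hC hL

theorem beltramiCoeff_eq_zero_of_hasDerivAt {G : ℂ → ℂ} {z a : ℂ} (h : HasDerivAt G a z) :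
    beltramiCoeff G z = 0 := by
  have h' := h.complexToReal_fderiv
  have : wirtingerZbar G z = 0 := by
    simp only [wirtingerZbar, h'.partialX_eq, h'.partialY_eq]
    simp [mul_comm I, mul_assoc]
  rw [beltramiCoeff, this, zero_div]

/-! ### The transition function near the corner -/

/-- The clamp of a real number to `[0, 1]`. -/
def ramp (t : ℝ) : ℝ := max 0 (min 1 t)

theorem ramp_nonneg (t : ℝ) : 0 ≤ ramp t := le_max_left _ _

theorem ramp_le_one (t : ℝ) : ramp t ≤ 1 := max_le zero_le_one (min_le_left _ _)

theorem ramp_of_nonpos {t : ℝ} (h : t ≤ 0) : ramp t = 0 := by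
  rw [ramp, min_eq_right (by linarith), max_eq_left h]

theorem ramp_of_one_le {t : ℝ} (h : 1 ≤ t) : ramp t = 1 := by
  rw [ramp, min_eq_left h, max_eq_right zero_le_one]

theorem ramp_of_mem {t : ℝ} (h0 : 0 ≤ t) (h : t ≤ 1) : ramp t = t := by
  rw [ramp, min_eq_right h, max_eq_right h0]

/-- The function `t ↦ exp (-2 t - 2 i (t - π / 3))`. -/
def spiral (t : ℝ) : ℂ := exp (⟨-2 * t, 2 * Real.pi / 3 - 2 * t⟩ : ℂ)

/-- The quotient of the map on the cut by the exponential. -/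
def cutFactor (t : ℝ) : ℂ := 1 + ramp (2 - t) * spiral t

/-- The logarithm of `cutFactor`. -/
def cutLog (t : ℝ) : ℂ := log (cutFactor t)

theorem norm_spiral (t : ℝ) : ‖spiral t‖ = Real.exp (-2 * t) := by
  rw [spiral, norm_exp]

theorem spiral_re (t : ℝ) :
    (spiral t).re = Real.exp (-2 * t) * Real.cos (2 * Real.pi / 3 - 2 * t) := by
  rw [spiral, exp_re]

theorem spiral_im (t : ℝ) :
    (spiral t).im = Real.exp (-2 * t) * Real.sin (2 * Real.pi / 3 - 2 * t) := by
  rw [spiral, exp_im]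

theorem cos_two_pi_div_three : Real.cos (2 * Real.pi / 3) = -1 / 2 := by
  rw [show 2 * Real.pi / 3 = Real.pi - Real.pi / 3 by ring, Real.cos_pi_sub, Real.cos_pi_div_three]
  norm_num

theorem exp_neg_two_lt : Real.exp (-2) < 0.14 := by
  have h : Real.exp (-2) = (Real.exp 1 * Real.exp 1)⁻¹ := by
    rw [← Real.exp_add, ← Real.exp_neg]; norm_num
  rw [h, inv_lt_comm₀ (by positivity) (by norm_num)]
  nlinarith [Real.exp_one_gt_d9]

theorem exp_neg_one_bounds : 0.36 < Real.exp (-1) ∧ Real.exp (-1) < 0.37 := by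
  rw [Real.exp_neg]
  constructor
  · rw [lt_inv_comm₀ (by norm_num) (by positivity)]
    linarith [Real.exp_one_lt_d9]
  · rw [inv_lt_comm₀ (by positivity) (by norm_num)]
    linarith [Real.exp_one_gt_d9]

/-- On [0, 1] the angle 2π/3 - 2t stays in [0, 2π/3]; afterwards the modulus is at most e⁻². The
bound keeps `cutFactor` in the right half-plane, where the principal logarithm is smooth. -/
theorem neg_half_le_spiral_re {t : ℝ} (ht : 0 ≤ t) : -1 / 2 ≤ (spiral t).re := by
  rcases le_total t 1 with h | h
  · rw [spiral_re]
    have hπ := Real.pi_gt_three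
    have hc : -1 / 2 ≤ Real.cos (2 * Real.pi / 3 - 2 * t) := by
      rw [← cos_two_pi_div_three]
      exact Real.cos_le_cos_of_nonneg_of_le_pi (by linarith) (by linarith) (by linarith)
    have h1 : Real.exp (-2 * t) ≤ 1 := Real.exp_le_one_iff.2 (by linarith)
    nlinarith [Real.exp_pos (-2 * t)]
  · have h1 : ‖spiral t‖ ≤ Real.exp (-2) := by
      rw [norm_spiral]; exact Real.exp_le_exp.2 (by linarith)
    have := (abs_le.1 (abs_re_le_norm (spiral t))).1
    linarith [exp_neg_two_lt]

theorem half_le_cutFactor_re {t : ℝ} (ht : 0 ≤ t) : 1 / 2 ≤ (cutFactor t).re := by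
  have h := neg_half_le_spiral_re ht
  have h0 := ramp_nonneg (2 - t)
  have h1 := ramp_le_one (2 - t)
  simp only [cutFactor, add_re, one_re, re_ofReal_mul]
  nlinarith

theorem cutFactor_mem_slitPlane {t : ℝ} (ht : 0 ≤ t) : cutFactor t ∈ slitPlane :=
  Or.inl (by linarith [half_le_cutFactor_re ht])

theorem cutFactor_ne_zero {t : ℝ} (ht : 0 ≤ t) : cutFactor t ≠ 0 :=
  slitPlane_ne_zero (cutFactor_mem_slitPlane ht)

theorem exp_cutLog {t : ℝ} (ht : 0 ≤ t) : exp (cutLog t) = cutFactor t :=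
  exp_log (cutFactor_ne_zero ht)

theorem abs_cutLog_im_lt {t : ℝ} (ht : 0 ≤ t) : |(cutLog t).im| < Real.pi / 2 := by
  rw [cutLog, log_im, abs_arg_lt_pi_div_two_iff]
  exact Or.inl (by linarith [half_le_cutFactor_re ht])

theorem cutFactor_of_two_le {t : ℝ} (ht : 2 ≤ t) : cutFactor t = 1 := by
  rw [cutFactor, ramp_of_nonpos (by linarith)]; simp

theorem cutLog_of_two_le {t : ℝ} (ht : 2 ≤ t) : cutLog t = 0 := by
  rw [cutLog, cutFactor_of_two_le ht, log_one]

theorem norm_cutFactor_le {t : ℝ} (ht : 0 ≤ t) : ‖cutFactor t‖ ≤ 2 := by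
  have h1 : ‖spiral t‖ ≤ 1 := by
    rw [norm_spiral]; exact Real.exp_le_one_iff.2 (by linarith)
  calc ‖cutFactor t‖ ≤ ‖(1 : ℂ)‖ + ‖(ramp (2 - t) : ℂ) * spiral t‖ := norm_add_le _ _
    _ ≤ 1 + 1 := by
      rw [norm_one, norm_mul, norm_real, Real.norm_of_nonneg (ramp_nonneg _)]
      have := mul_le_one₀ (ramp_le_one (2 - t)) (norm_nonneg _) h1
      linarith
    _ = 2 := by norm_num

/-- This is 1 + e^(2πi/3) = e^(πi/3): the logarithm supplies exactly the π/3 by which R falls short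
of dπ. -/
theorem cutLog_zero : cutLog 0 = (⟨0, Real.pi / 3⟩ : ℂ) := by
  have h : cutFactor 0 = exp (⟨0, Real.pi / 3⟩ : ℂ) := by
    rw [cutFactor, ramp_of_one_le (by norm_num)]
    apply Complex.ext
    · rw [add_re, re_ofReal_mul, spiral_re, exp_re]
      simp [cos_two_pi_div_three, Real.cos_pi_div_three]; norm_num
    · rw [add_im, im_ofReal_mul, spiral_im, exp_im]
      simp only [mul_zero, sub_zero, Real.exp_zero, one_im]
      rw [show 2 * Real.pi / 3 = Real.pi - Real.pi / 3 by ring, Real.sin_pi_sub]; ring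
  rw [cutLog, h, log_exp]
  · simp only; linarith [Real.pi_pos]
  · simp only; linarith [Real.pi_pos]

theorem hasDerivAt_spiral (t : ℝ) : HasDerivAt spiral ((⟨-2, -2⟩ : ℂ) * spiral t) t := by
  have h : HasDerivAt (fun s : ℝ => (⟨-2 * s, 2 * Real.pi / 3 - 2 * s⟩ : ℂ)) (⟨-2, -2⟩ : ℂ) t := by
    have e : (fun s : ℝ => (⟨-2 * s, 2 * Real.pi / 3 - 2 * s⟩ : ℂ)) =
        fun s : ℝ => (⟨-2, -2⟩ : ℂ) * (s : ℂ) + (⟨0, 2 * Real.pi / 3⟩ : ℂ) := by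
      funext s
      apply Complex.ext <;> simp
      ring
    rw [e]
    simpa using ((ofRealCLM.hasDerivAt (x := t)).const_mul (⟨-2, -2⟩ : ℂ)).add_const
      (⟨0, 2 * Real.pi / 3⟩ : ℂ)
  have := h.cexp
  rw [mul_comm]
  exact this

theorem norm_neg_two_neg_two_le : ‖(⟨-2, -2⟩ : ℂ)‖ ≤ 3 := by
  have : ‖(⟨-2, -2⟩ : ℂ)‖ ^ 2 ≤ 3 ^ 2 := by
    rw [Complex.sq_norm_eq]; norm_num
  exact (pow_le_pow_iff_left₀ (norm_nonneg _) (by norm_num) two_ne_zero).1 this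

/-- The number 1 + Re p is the derivative of Re Φ along the cut, a diagonal entry of the last
triangular factor. On (0, 1), with s the spiral, it equals (1 - |s|² + 2 Im s)/|1 + s|², at least
(1/3)/4. On (1, 2) one has |p| ≤ 2/3, and beyond 2 the derivative vanishes. -/
theorem exists_hasDerivAt_cutLog {t : ℝ} (h0 : 0 < t) (h1 : t ≠ 1) (h2 : t ≠ 2) :
    ∃ p : ℂ, HasDerivAt cutLog p t ∧ 1 / 12 ≤ 1 + p.re ∧ ‖p‖ ≤ 8 := by
  rcases lt_or_gt_of_ne h1 with h1 | h1
  · have hE : HasDerivAt cutFactor ((⟨-2, -2⟩ : ℂ) * spiral t) t := by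
      refine ((hasDerivAt_spiral t).const_add 1).congr_of_eventuallyEq ?_
      filter_upwards [Iio_mem_nhds h1] with s hs
      rw [cutFactor, ramp_of_one_le (by linarith [mem_Iio.1 hs])]; simp
    have hF : cutFactor t = 1 + spiral t := by
      rw [cutFactor, ramp_of_one_le (by linarith)]; simp
    refine ⟨_, hE.clog_real (cutFactor_mem_slitPlane h0.le), ?_, ?_⟩
    · have hne := cutFactor_ne_zero h0.le
      have hn : normSq (cutFactor t) ≤ 4 := by
        rw [← Complex.sq_norm]; nlinarith [norm_cutFactor_le h0.le, norm_nonneg (cutFactor t)]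
      have hpos : 0 < normSq (cutFactor t) := normSq_pos.2 hne
      have hs : (spiral t).re ^ 2 + (spiral t).im ^ 2 = Real.exp (-2 * t) ^ 2 := by
        rw [← Complex.sq_norm_eq, norm_spiral]
      have him := spiral_im t
      have hN : 1 / 3 ≤ 1 - ((spiral t).re ^ 2 + (spiral t).im ^ 2) + 2 * (spiral t).im := by
        rw [hs, him]
        have hπ := Real.pi_gt_three
        have hπ' := Real.pi_lt_d2
        have hb := exp_neg_one_bounds
        have hpos := Real.exp_pos (-2 * t)
        have hle : Real.exp (-2 * t) ≤ 1 := Real.exp_le_one_iff.2 (by linarith)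
        -- For t ≤ 1/2 the sine is at least 1/2, so 2 Im s ≥ |s| ≥ |s|². For t ≥ 1/2 already |s| ≤
        -- e⁻¹ and Im s ≥ 0.
        rcases le_total t (1 / 2) with ht | ht
        · have hge : Real.exp (-1) ≤ Real.exp (-2 * t) := Real.exp_le_exp.2 (by linarith)
          have hsin : 1 / 2 ≤ Real.sin (2 * Real.pi / 3 - 2 * t) := by
            rw [← Real.cos_pi_div_two_sub, ← Real.cos_abs, ← Real.cos_pi_div_three]
            refine Real.cos_le_cos_of_nonneg_of_le_pi (abs_nonneg _) (by linarith) ?_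
            rw [abs_le]; constructor <;> linarith
          nlinarith
        · have hge : Real.exp (-2 * t) ≤ Real.exp (-1) := Real.exp_le_exp.2 (by linarith)
          have hsin : 0 ≤ Real.sin (2 * Real.pi / 3 - 2 * t) :=
            Real.sin_nonneg_of_nonneg_of_le_pi (by linarith) (by linarith)
          nlinarith [mul_nonneg hpos.le hsin]
      have hre : 1 + (((⟨-2, -2⟩ : ℂ) * spiral t) / cutFactor t).re =
          (1 - ((spiral t).re ^ 2 + (spiral t).im ^ 2) + 2 * (spiral t).im) /
            normSq (cutFactor t) := by
        rw [div_re]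
        field_simp
        rw [normSq_apply, hF]
        simp
        ring
      rw [hre, le_div_iff₀ hpos]
      linarith
    · rw [norm_div, norm_mul]
      have hn : 1 / 2 ≤ ‖cutFactor t‖ :=
        (half_le_cutFactor_re h0.le).trans (re_le_norm _)
      have h1 : ‖spiral t‖ ≤ 1 := by
        rw [norm_spiral]; exact Real.exp_le_one_iff.2 (by linarith)
      rw [div_le_iff₀ (by linarith)]
      nlinarith [norm_neg_two_neg_two_le, norm_nonneg (spiral t), norm_nonneg (⟨-2, -2⟩ : ℂ)]
  · rcases lt_or_gt_of_ne h2 with h2 | h2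
    · have hE : HasDerivAt cutFactor
          (-spiral t + ((2 - t : ℝ) : ℂ) * ((⟨-2, -2⟩ : ℂ) * spiral t)) t := by
        have hr : HasDerivAt (fun s : ℝ => ((2 - s : ℝ) : ℂ)) (-1) t := by
          have := ((hasDerivAt_id t).const_sub 2).ofReal_comp
          simpa using this
        have := (hr.mul (hasDerivAt_spiral t)).const_add 1
        rw [neg_one_mul] at this
        refine this.congr_of_eventuallyEq ?_
        filter_upwards [Ioo_mem_nhds h1 h2] with s hs
        rw [cutFactor, ramp_of_mem (by linarith [hs.2]) (by linarith [hs.1])]; rfl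
      have hs : ‖spiral t‖ ≤ 0.14 := by
        rw [norm_spiral]
        exact (Real.exp_le_exp.2 (by linarith)).trans exp_neg_two_lt.le
      have hnum : ‖-spiral t + ((2 - t : ℝ) : ℂ) * ((⟨-2, -2⟩ : ℂ) * spiral t)‖ ≤ 0.56 := by
        refine (norm_add_le _ _).trans ?_
        rw [norm_neg, norm_mul, norm_mul, norm_real, Real.norm_of_nonneg (by linarith)]
        have hA : ‖(⟨-2, -2⟩ : ℂ)‖ * ‖spiral t‖ ≤ 3 * 0.14 :=
          mul_le_mul norm_neg_two_neg_two_le hs (norm_nonneg _) (by norm_num)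
        have hB := mul_nonneg (norm_nonneg (⟨-2, -2⟩ : ℂ)) (norm_nonneg (spiral t))
        nlinarith
      have hden : 0.86 ≤ ‖cutFactor t‖ := by
        have : ‖(ramp (2 - t) : ℂ) * spiral t‖ ≤ 0.14 := by
          rw [norm_mul, norm_real, Real.norm_of_nonneg (ramp_nonneg _)]
          nlinarith [ramp_le_one (2 - t), ramp_nonneg (2 - t), norm_nonneg (spiral t)]
        have h3 := norm_sub_norm_le (1 : ℂ) (-((ramp (2 - t) : ℂ) * spiral t))
        rw [norm_one, norm_neg, sub_neg_eq_add] at h3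
        rw [cutFactor]
        linarith
      have hp : ‖(-spiral t + ((2 - t : ℝ) : ℂ) * ((⟨-2, -2⟩ : ℂ) * spiral t)) / cutFactor t‖
          ≤ 2 / 3 := by
        rw [norm_div, div_le_iff₀ (by linarith)]
        linarith
      refine ⟨_, hE.clog_real (cutFactor_mem_slitPlane h0.le), ?_, by linarith⟩
      have := (abs_le.1 (abs_re_le_norm ((-spiral t + ((2 - t : ℝ) : ℂ) *
        ((⟨-2, -2⟩ : ℂ) * spiral t)) / cutFactor t))).1
      linarith
    · refine ⟨0, ?_, by norm_num, by norm_num⟩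
      refine (hasDerivAt_const t (0 : ℂ)).congr_of_eventuallyEq ?_
      filter_upwards [Ioi_mem_nhds h2] with s hs
      exact cutLog_of_two_le (le_of_lt hs)

theorem locallyLipschitz_ramp : LocallyLipschitz ramp :=
  (LocallyLipschitz.id.const_min 1).const_max 0

theorem locallyLipschitz_spiral : LocallyLipschitz spiral := by
  unfold spiral
  refine LocallyLipschitz.cexp (LocallyLipschitz.complexMk ?_ ?_)
  · exact LocallyLipschitz.id.contDiff_comp (g := fun t : ℝ => -2 * t) (by fun_prop)
  · exact LocallyLipschitz.id.contDiff_comp (g := fun t : ℝ => 2 * Real.pi / 3 - 2 * t)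
      (by fun_prop)

theorem locallyLipschitz_cutLog_comp {α : Type*} [PseudoEMetricSpace α] {f : α → ℝ}
    (hf : LocallyLipschitz f) (h0 : ∀ x, 0 ≤ f x) : LocallyLipschitz (fun x => cutLog (f x)) := by
  have hF : LocallyLipschitz (fun x => cutFactor (f x)) := by
    unfold cutFactor
    refine (LocallyLipschitz.const (1 : ℂ)).add (LocallyLipschitz.mul_algebra ?_ ?_)
    · refine LocallyLipschitz.ofReal (locallyLipschitz_ramp.comp ?_)
      exact hf.contDiff_comp (g := fun t : ℝ => 2 - t) (by fun_prop)
    · exact locallyLipschitz_spiral.comp hf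
  unfold cutLog
  refine hF.contDiffAt_comp fun x => ?_
  exact (contDiffAt_log (cutFactor_mem_slitPlane (h0 x))).restrict_scalars ℝ

/-! ### The interpolating map in the first quadrant -/

/-- The size conditions on the radius `R` of the disc and on the half side `L` of the square. -/
structure Admissible (R L : ℝ) : Prop where
  third_le : L / 3 ≤ R
  le_half : R ≤ L / 2
  four_le : 4 ≤ L - R
  pi_le : 2 * Real.pi / 3 ≤ R
  six_le : 6 ≤ L

/-- The height of the cut over the point `x` of the real axis. -/
def cutHeight (R L x : ℝ) : ℝ := R + min (max x 0) (L - R)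

/-- The slope coordinate, equal to `0` on the real axis and to `1` on the cut. -/
def pencilCoord (R L : ℝ) (z : ℂ) : ℝ := z.im / cutHeight R L z.re

/-- The cosine of an angle in terms of the tangent of its half. -/
def stereoCos (Y : ℝ) : ℝ := (1 - Y ^ 2) / (1 + Y ^ 2)

/-- The leaf coordinate, equal to `0` on the circle of radius `R`, to `Re z` on the cut and to `L`
on the line `Re z = L`. -/
def leafCoord (R L : ℝ) (z : ℂ) : ℝ :=
  L - L * (L - z.re) * (L - R * stereoCos (pencilCoord R L z))⁻¹

/-- The nonnegative part of the leaf coordinate. -/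
def leafParam (R L : ℝ) (z : ℂ) : ℝ := max (leafCoord R L z) 0

/-- The interpolation between the angular parametrization of the circle and the affine
parametrization of the vertical side. -/
def blend (L t Y : ℝ) : ℝ := (1 - t / L) * (4 / Real.pi * Real.arctan Y) + t / L * Y

/-- The map to the logarithmic plane in the coordinates `(t, Y)`. -/
def logModel (R L t Y : ℝ) : ℂ :=
  ⟨t + (cutLog t).re, (cutHeight R L t + (cutLog t).im) * blend L t Y⟩

/-- The logarithmic coordinate below the cut. -/
def logMap (R L : ℝ) (z : ℂ) : ℂ := logModel R L (leafParam R L z) (pencilCoord R L z)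

/-- The interpolating map below the cut. -/
def lowerMap (R L : ℝ) (z : ℂ) : ℂ :=
  exp (logMap R L z) + (ramp (leafParam R L z - 2) : ℂ) * exp (-logMap R L z)

/-- The coefficient of the exponential with negative exponent above the cut. -/
def upperCoeff (R : ℝ) (z : ℂ) : ℝ := min 1 (max |z.re - 2| (z.im - R - 3))

/-- The interpolating map above the cut. -/
def upperMap (R : ℝ) (z : ℂ) : ℂ := exp z + (upperCoeff R z : ℂ) * exp (-z)

variable {R L : ℝ}

/-! ### Bounds on the coordinates and the three triangular factors. -/

theorem Admissible.pos (h : Admissible R L) : 0 < R := by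
  linarith [h.pi_le, Real.pi_pos]

theorem Admissible.pos' (h : Admissible R L) : 0 < L := by linarith [h.six_le]

theorem le_cutHeight (h : Admissible R L) (x : ℝ) : R ≤ cutHeight R L x := by
  have : 0 ≤ min (max x 0) (L - R) := le_min (le_max_right _ _) (by linarith [h.four_le])
  rw [cutHeight]; linarith

theorem cutHeight_le (x : ℝ) : cutHeight R L x ≤ L := by
  have : min (max x 0) (L - R) ≤ L - R := min_le_right _ _
  rw [cutHeight]; linarith

theorem cutHeight_pos (h : Admissible R L) (x : ℝ) : 0 < cutHeight R L x :=
  h.pos.trans_le (le_cutHeight h x)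

theorem stereoCos_le_one (Y : ℝ) : stereoCos Y ≤ 1 := by
  rw [stereoCos, div_le_one (by positivity)]; nlinarith

theorem half_le_sub_stereoCos (h : Admissible R L) (Y : ℝ) : L / 2 ≤ L - R * stereoCos Y := by
  nlinarith [stereoCos_le_one Y, h.pos, h.le_half]

theorem sub_stereoCos_ne_zero (h : Admissible R L) (Y : ℝ) : L - R * stereoCos Y ≠ 0 := by
  have := half_le_sub_stereoCos h Y
  have := h.pos'
  linarith

theorem HasFDerivAt.exists_complexMk {f g : ℂ → ℝ} {A B : ℂ →L[ℝ] ℝ} {z : ℂ}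
    (hf : HasFDerivAt f A z) (hg : HasFDerivAt g B z) :
    ∃ M : ℂ →L[ℝ] ℂ, HasFDerivAt (fun w => (⟨f w, g w⟩ : ℂ)) M z ∧ ∀ v, M v = ⟨A v, B v⟩ := by
  refine ⟨equivRealProdCLM.symm.toContinuousLinearMap.comp (A.prod B),
    (equivRealProdCLM.symm.toContinuousLinearMap.hasFDerivAt).comp z (hf.prodMk hg), ?_⟩
  intro v
  rfl

theorem hasDerivAt_cutHeight {x : ℝ} (h0 : 0 < x) (h1 : x ≠ L - R) :
    ∃ c, HasDerivAt (cutHeight R L) c x ∧ 0 ≤ c ∧ c ≤ 1 := by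
  rcases lt_or_gt_of_ne h1 with h1 | h1
  · refine ⟨1, ?_, zero_le_one, le_rfl⟩
    refine ((hasDerivAt_id x).const_add R).congr_of_eventuallyEq ?_
    filter_upwards [Ioo_mem_nhds h0 h1] with y hy
    rw [cutHeight, max_eq_left hy.1.le, min_eq_left hy.2.le]; rfl
  · refine ⟨0, ?_, le_rfl, zero_le_one⟩
    refine (hasDerivAt_const x (R + (L - R))).congr_of_eventuallyEq ?_
    filter_upwards [Ioi_mem_nhds h0, Ioi_mem_nhds h1] with y hy hy'
    rw [cutHeight, max_eq_left (le_of_lt hy), min_eq_right (le_of_lt hy')]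

/-- The first triangular factor of the logarithmic coordinate. -/
theorem exists_distortion_pencil (h : Admissible R L) {z : ℂ} (h0 : 0 < z.re)
    (h1 : z.re ≠ L - R) (hy : 0 ≤ z.im) (hy' : z.im ≤ cutHeight R L z.re) :
    ∃ M : ℂ →L[ℝ] ℂ, HasFDerivAt (fun w : ℂ => (⟨w.re, L * pencilCoord R L w⟩ : ℂ)) M z ∧
      HasDistortionLE (3 * 3 ^ 2 / 1 ^ 2) M := by
  obtain ⟨c, hc, hc0, hc1⟩ := hasDerivAt_cutHeight (R := R) (L := L) h0 h1
  have hpos := cutHeight_pos h z.re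
  have hcR := le_cutHeight h z.re
  have hcL := cutHeight_le (R := R) (L := L) z.re
  have hL := h.pos'
  have hA : HasFDerivAt (fun w : ℂ => w.re) reCLM z := reCLM.hasFDerivAt
  have hi : HasFDerivAt (fun w : ℂ => w.im) imCLM z := imCLM.hasFDerivAt
  have hinv := (hc.inv hpos.ne').comp_hasFDerivAt z hA
  have hB := (hi.mul hinv).const_mul L
  obtain ⟨M, hM, hMv⟩ := hA.exists_complexMk hB
  refine ⟨M, hM.congr_of_eventuallyEq (.of_forall fun w => ?_), ?_⟩
  · simp [pencilCoord, div_eq_mul_inv]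
  · have e1 : M 1 = ⟨1, L * (z.im * (-c / cutHeight R L z.re ^ 2))⟩ := by
      rw [hMv]; simp
    have e2 : M I = ⟨0, L * (cutHeight R L z.re)⁻¹⟩ := by
      rw [hMv]; simp
    have hq : L * (cutHeight R L z.re)⁻¹ ≤ 3 := by
      rw [← div_eq_mul_inv, div_le_iff₀ hpos]; linarith [h.third_le]
    refine HasDistortionLE.of_triangular one_pos ?_ ?_ ?_ ?_ (Or.inr ⟨?_, ?_⟩)
    · rw [e1]
    · rw [e1]; norm_num
    · rw [e2]
      change 1 ≤ L * (cutHeight R L z.re)⁻¹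
      rw [← div_eq_mul_inv, le_div_iff₀ hpos]; linarith
    · rw [e2]; exact hq
    · rw [e2]
    · rw [e1]
      change |L * (z.im * (-c / cutHeight R L z.re ^ 2))| ≤ 3
      have e : L * (z.im * (-c / cutHeight R L z.re ^ 2)) =
          -((L * (cutHeight R L z.re)⁻¹) * (z.im / cutHeight R L z.re * c)) := by
        field_simp
      have hY : z.im / cutHeight R L z.re ≤ 1 := (div_le_one hpos).2 hy'
      have hY0 : 0 ≤ z.im / cutHeight R L z.re := by positivity
      have hq0 : 0 ≤ L * (cutHeight R L z.re)⁻¹ := by positivity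
      rw [e, abs_neg, abs_of_nonneg (by positivity)]
      have hb : z.im / cutHeight R L z.re * c ≤ 1 := mul_le_one₀ hY hc0 hc1
      have hb0 : 0 ≤ z.im / cutHeight R L z.re * c := by positivity
      nlinarith

theorem hasDerivAt_stereoCos (Y : ℝ) :
    HasDerivAt stereoCos (-4 * Y / (1 + Y ^ 2) ^ 2) Y := by
  have h1 : HasDerivAt (fun Y : ℝ => 1 - Y ^ 2) (-(2 * Y)) Y := by
    simpa using (hasDerivAt_pow 2 Y).const_sub 1
  have h2 : HasDerivAt (fun Y : ℝ => 1 + Y ^ 2) (2 * Y) Y := by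
    simpa using (hasDerivAt_pow 2 Y).const_add 1
  refine (h1.div h2 (by positivity)).congr_deriv ?_
  ring

theorem abs_deriv_stereoCos_le {Y : ℝ} (h0 : 0 ≤ Y) (h1 : Y ≤ 1) :
    |-4 * Y / (1 + Y ^ 2) ^ 2| ≤ 4 := by
  have e : |(1 + Y ^ 2) ^ 2| = (1 + Y ^ 2) ^ 2 := abs_of_nonneg (by positivity)
  rw [abs_div, abs_mul, abs_of_nonneg h0, e, div_le_iff₀ (by positivity)]
  norm_num
  nlinarith [sq_nonneg Y, sq_nonneg (Y ^ 2)]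

/-- The second triangular factor of the logarithmic coordinate. -/
theorem exists_distortion_leaf (h : Admissible R L) {w : ℂ} (hx0 : 0 ≤ w.re) (hx : w.re ≤ L)
    (hm0 : 0 ≤ w.im / L) (hm : w.im / L ≤ 1) :
    ∃ M : ℂ →L[ℝ] ℂ, HasFDerivAt
      (fun u : ℂ => (⟨L - L * (L - u.re) * (L - R * stereoCos (u.im / L))⁻¹, u.im⟩ : ℂ)) M w ∧
      HasDistortionLE (3 * 8 ^ 2 / 1 ^ 2) M := by
  have hL := h.pos'
  have hR := h.pos
  have hA : HasFDerivAt (fun w : ℂ => w.re) reCLM w := reCLM.hasFDerivAt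
  have hi : HasFDerivAt (fun w : ℂ => w.im) imCLM w := imCLM.hasFDerivAt
  have hden := half_le_sub_stereoCos h (w.im / L)
  have hden' : L - R * stereoCos (w.im / L) ≤ L := by
    have : 0 ≤ stereoCos (w.im / L) := by
      rw [stereoCos]
      apply div_nonneg <;> nlinarith
    nlinarith
  have hk := (hasDerivAt_stereoCos (w.im / L)).comp (w.im)
    ((hasDerivAt_id (w.im)).div_const L)
  have hk2 := ((hk.const_mul R).const_sub L).inv (sub_stereoCos_ne_zero h _)
  have hk3 := hk2.comp_hasFDerivAt w hi
  have hB := (((hA.const_sub L).const_mul L).mul hk3).const_sub L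
  obtain ⟨M, hM, hMv⟩ := hB.exists_complexMk hi
  obtain ⟨D, hD⟩ : ∃ D, D = L - R * stereoCos (w.im / L) := ⟨_, rfl⟩
  have hDpos : 0 < D := by rw [hD]; linarith
  obtain ⟨k', hk'⟩ : ∃ k', k' = -4 * (w.im / L) / (1 + (w.im / L) ^ 2) ^ 2 := ⟨_, rfl⟩
  have hkb : |k'| ≤ 4 := hk' ▸ abs_deriv_stereoCos_le hm0 hm
  refine ⟨M, hM.congr_of_eventuallyEq (.of_forall fun w => ?_), ?_⟩
  · simp
  · have e1 : M 1 = ⟨L * D⁻¹, 0⟩ := by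
      rw [hMv, hD]; simp; ring
    have e2 : M I = ⟨-((L - w.re) * (R * k') * (D ^ 2)⁻¹), 1⟩ := by
      rw [hMv, hk', hD]; simp; field_simp
    rw [← hD] at hden hden'
    refine HasDistortionLE.of_triangular one_pos ?_ ?_ ?_ ?_ (Or.inl ⟨?_, ?_⟩)
    · rw [e1]
      change 1 ≤ L * D⁻¹
      rw [← div_eq_mul_inv, le_div_iff₀ hDpos]; linarith
    · rw [e1]
      change L * D⁻¹ ≤ 8
      rw [← div_eq_mul_inv, div_le_iff₀ hDpos]; linarith
    · rw [e2]
    · rw [e2]; norm_num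
    · rw [e1]
    · rw [e2]
      change |-((L - w.re) * (R * k') * (D ^ 2)⁻¹)| ≤ 8
      rw [abs_neg, ← div_eq_mul_inv, abs_div, abs_mul, abs_mul,
        abs_of_nonneg (sub_nonneg.2 hx), abs_of_pos hR, abs_of_nonneg (sq_nonneg D),
        div_le_iff₀ (by positivity)]
      calc (L - w.re) * (R * |k'|) ≤ L * (L / 2 * 4) := by
            gcongr
            · linarith
            · exact h.le_half
        _ = 8 * (L / 2) ^ 2 := by ring
        _ ≤ 8 * D ^ 2 := by gcongr

theorem blend_nonneg (h : Admissible R L) {t Y : ℝ} (ht0 : 0 ≤ t) (ht : t ≤ L) (hY0 : 0 ≤ Y) :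
    0 ≤ blend L t Y := by
  have h1 : t / L ≤ 1 := (div_le_one h.pos').2 ht
  have h2 : 0 ≤ t / L := div_nonneg ht0 h.pos'.le
  have h3 : 0 ≤ Real.arctan Y := by
    rw [← Real.arctan_zero]; exact Real.arctan_mono hY0
  have := Real.pi_pos
  exact add_nonneg (mul_nonneg (by linarith) (by positivity)) (by positivity)

theorem arctan_factor_le_one {Y : ℝ} (hY : Y ≤ 1) : 4 / Real.pi * Real.arctan Y ≤ 1 := by
  have h1 : Real.arctan Y ≤ Real.pi / 4 := by
    rw [← Real.arctan_one]; exact Real.arctan_mono hY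
  have := Real.pi_pos
  rw [div_mul_eq_mul_div, div_le_one this]; linarith

theorem blend_le_one (h : Admissible R L) {t Y : ℝ} (ht0 : 0 ≤ t) (ht : t ≤ L) (hY : Y ≤ 1) :
    blend L t Y ≤ 1 := by
  have h1 : t / L ≤ 1 := (div_le_one h.pos').2 ht
  have h2 : 0 ≤ t / L := div_nonneg ht0 h.pos'.le
  have h3 := arctan_factor_le_one hY
  rw [blend]; nlinarith

/-- The third triangular factor of the logarithmic coordinate. -/
theorem exists_distortion_logModel (h : Admissible R L) {w : ℂ} (hx0 : 0 < w.re) (hx : w.re ≤ L)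
    (h1 : w.re ≠ 1) (h2 : w.re ≠ 2) (h3 : w.re ≠ L - R)
    (hm0 : 0 ≤ w.im / L) (hm : w.im / L ≤ 1) :
    ∃ M : ℂ →L[ℝ] ℂ, HasFDerivAt (fun u : ℂ => logModel R L u.re (u.im / L)) M w ∧
      HasDistortionLE (3 * 11 ^ 2 / (1 / 24) ^ 2) M := by
  have hL := h.pos'
  have hR := h.pos
  have hA : HasFDerivAt (fun w : ℂ => w.re) reCLM w := reCLM.hasFDerivAt
  have hi : HasFDerivAt (fun w : ℂ => w.im) imCLM w := imCLM.hasFDerivAt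
  obtain ⟨p, hp, hp1, hp2⟩ := exists_hasDerivAt_cutLog hx0 h1 h2
  obtain ⟨c, hc, hc0, hc1⟩ := hasDerivAt_cutHeight (R := R) (L := L) hx0 h3
  have hre : HasDerivAt (fun t => (cutLog t).re) p.re w.re :=
    reCLM.hasFDerivAt.comp_hasDerivAt w.re hp
  have him : HasDerivAt (fun t => (cutLog t).im) p.im w.re :=
    imCLM.hasFDerivAt.comp_hasDerivAt w.re hp
  have hU := ((hasDerivAt_id w.re).add hre).comp_hasFDerivAt w hA
  have hC := (hc.add him).comp_hasFDerivAt w hA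
  have hY := hi.const_mul L⁻¹
  have ht := hA.const_mul L⁻¹
  have hat := (hY.arctan).const_mul (4 / Real.pi)
  have hbl := ((ht.const_sub 1).mul hat).add (ht.mul hY)
  obtain ⟨M, hM, hMv⟩ := hU.exists_complexMk (hC.mul hbl)
  refine ⟨M, hM.congr_of_eventuallyEq (.of_forall fun u => ?_), ?_⟩
  · simp [logModel, blend, div_eq_mul_inv, mul_comm L⁻¹]
  obtain ⟨Y, hYd⟩ : ∃ Y, Y = w.im / L := ⟨_, rfl⟩
  obtain ⟨s, hs⟩ : ∃ s, s = w.re / L := ⟨_, rfl⟩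
  obtain ⟨q, hq⟩ : ∃ q, q = cutHeight R L w.re + (cutLog w.re).im := ⟨_, rfl⟩
  have hYL : L⁻¹ * w.im = Y := by rw [hYd]; ring
  have hsL : L⁻¹ * w.re = s := by rw [hs]; ring
  rw [← hYd] at hm0 hm
  have hs0 : 0 ≤ s := by rw [hs]; positivity
  have hs1 : s ≤ 1 := by rw [hs, div_le_one hL]; exact hx
  have hπ := Real.pi_gt_three
  have hπ4 := Real.pi_le_four
  -- From R ≥ 2π/3 one gets π/2 ≤ 3R/4, hence q ≥ R/4 ≥ L/12.
  have hq0 : L / 12 ≤ q := by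
    have := (abs_lt.1 (abs_cutLog_im_lt hx0.le)).1
    have := le_cutHeight h w.re
    rw [hq]; linarith [h.pi_le, h.third_le]
  have hq1 : q ≤ 2 * L := by
    have := (abs_lt.1 (abs_cutLog_im_lt hx0.le)).2
    have := cutHeight_le (R := R) (L := L) w.re
    rw [hq]; linarith [h.six_le]
  have e1 : M 1 = ⟨1 + p.re, q * (L⁻¹ * (Y - 4 / Real.pi * Real.arctan Y)) +
      blend L w.re Y * (c + p.im)⟩ := by
    rw [hMv]
    simp [hYL, hsL, ← hq, blend, ← hs]
    ring
  have e2 : M I = ⟨0, q * L⁻¹ * ((1 - s) * (4 / Real.pi / (1 + Y ^ 2)) + s)⟩ := by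
    rw [hMv]
    simp [hYL, hsL, ← hq]
    ring
  have hg1 : 1 / 2 ≤ 4 / Real.pi / (1 + Y ^ 2) := by
    rw [div_div, le_div_iff₀ (by positivity)]; nlinarith
  have hg2 : 4 / Real.pi / (1 + Y ^ 2) ≤ 2 := by
    rw [div_div, div_le_iff₀ (by positivity)]; nlinarith
  have hβ1 : 1 / 2 ≤ (1 - s) * (4 / Real.pi / (1 + Y ^ 2)) + s := by nlinarith
  have hβ2 : (1 - s) * (4 / Real.pi / (1 + Y ^ 2)) + s ≤ 2 := by nlinarith
  have hr1 : 1 / 12 ≤ q * L⁻¹ := by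
    rw [← div_eq_mul_inv, le_div_iff₀ hL]; linarith
  have hr2 : q * L⁻¹ ≤ 2 := by
    rw [← div_eq_mul_inv, div_le_iff₀ hL]; linarith
  -- Here 1/24 = 1/12 · 1/2, and 11 = 2 · 1 + 1 · 9 bounds the off-diagonal entry.
  refine HasDistortionLE.of_triangular (by norm_num) ?_ ?_ ?_ ?_ (Or.inr ⟨?_, ?_⟩)
  · rw [e1]; change 1 / 24 ≤ 1 + p.re; linarith
  · rw [e1]; change 1 + p.re ≤ 11
    linarith [(abs_le.1 (abs_re_le_norm p)).2]
  · rw [e2]; change 1 / 24 ≤ q * L⁻¹ * _; nlinarith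
  · rw [e2]; change q * L⁻¹ * _ ≤ 11; nlinarith
  · rw [e2]
  · rw [e1]
    change |q * (L⁻¹ * (Y - 4 / Real.pi * Real.arctan Y)) + blend L w.re Y * (c + p.im)| ≤ 11
    rw [← mul_assoc]
    have hat0 : 0 ≤ 4 / Real.pi * Real.arctan Y := by
      have : 0 ≤ Real.arctan Y := by
        rw [← Real.arctan_zero]; exact Real.arctan_mono hm0
      positivity
    have hat1 := arctan_factor_le_one hm
    have hA1 : |Y - 4 / Real.pi * Real.arctan Y| ≤ 1 := by
      rw [abs_le]; constructor <;> linarith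
    have hA2 : |c + p.im| ≤ 9 := by
      have := abs_le.1 ((abs_im_le_norm p).trans hp2)
      rw [abs_le]; constructor <;> linarith
    have hb0 := blend_nonneg h hx0.le hx hm0
    have hb1 := blend_le_one h hx0.le hx hm
    refine (abs_add_le _ _).trans ?_
    rw [abs_mul (q * L⁻¹), abs_mul (blend L w.re Y), abs_of_nonneg (by linarith : 0 ≤ q * L⁻¹),
      abs_of_nonneg hb0]
    nlinarith [mul_le_mul hr2 hA1 (abs_nonneg _) zero_le_two,
      mul_le_mul hb1 hA2 (abs_nonneg _) zero_le_one]

theorem leafCoord_pos_iff (h : Admissible R L) (z : ℂ) :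
    0 < leafCoord R L z ↔ R * stereoCos (pencilCoord R L z) < z.re := by
  have hD := half_le_sub_stereoCos h (pencilCoord R L z)
  have hL := h.pos'
  rw [leafCoord, sub_pos, ← div_eq_mul_inv, div_lt_iff₀ (by linarith)]
  constructor
  · intro h'; have := lt_of_mul_lt_mul_left h' hL.le; linarith
  · intro h'; exact mul_lt_mul_of_pos_left (by linarith) hL

/-! ### Local Lipschitz continuity of the pieces. -/

theorem locallyLipschitz_cutHeight : LocallyLipschitz (cutHeight R L) :=
  (LocallyLipschitz.const R).add ((LocallyLipschitz.id.max_const 0).min_const (L - R))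

theorem locallyLipschitz_pencilCoord (h : Admissible R L) :
    LocallyLipschitz (pencilCoord R L) :=
  (LocallyLipschitz.id.im).div_real (locallyLipschitz_cutHeight.comp LocallyLipschitz.id.re)
    fun z => (cutHeight_pos h z.re).ne'

theorem contDiff_stereoCos : ContDiff ℝ 1 stereoCos := by
  unfold stereoCos
  exact (by fun_prop : ContDiff ℝ 1 fun Y : ℝ => 1 - Y ^ 2).div (by fun_prop)
    fun x => by positivity

theorem locallyLipschitz_leafCoord (h : Admissible R L) : LocallyLipschitz (leafCoord R L) := by
  have h1 := (locallyLipschitz_pencilCoord h).contDiff_comp contDiff_stereoCos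
  refine (h1.prodMk (LocallyLipschitz.id (α := ℂ)).re).contDiffAt_comp
    (g := fun p : ℝ × ℝ => L - L * (L - p.2) * (L - R * p.1)⁻¹) fun z => ?_
  have h2 : ContDiffAt ℝ 1 (fun p : ℝ × ℝ => (L - R * p.1)⁻¹)
      (stereoCos (pencilCoord R L z), z.re) :=
    ContDiffAt.inv (by fun_prop) (sub_stereoCos_ne_zero h _)
  exact contDiffAt_const.sub (ContDiffAt.mul (by fun_prop) h2)

theorem leafParam_nonneg (z : ℂ) : 0 ≤ leafParam R L z := le_max_right _ _

theorem locallyLipschitz_leafParam (h : Admissible R L) : LocallyLipschitz (leafParam R L) :=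
  (locallyLipschitz_leafCoord h).max_const 0

/-- The logarithm `cutLog` is controlled only for nonnegative arguments, hence the use of the
nonnegative part of the leaf coordinate. -/
theorem locallyLipschitz_logMap (h : Admissible R L) : LocallyLipschitz (logMap R L) := by
  have ht := locallyLipschitz_leafParam h
  have hY := locallyLipschitz_pencilCoord h
  have hP := locallyLipschitz_cutLog_comp ht leafParam_nonneg
  refine LocallyLipschitz.complexMk (ht.add hP.re) (LocallyLipschitz.mul_algebra
    ((locallyLipschitz_cutHeight.comp ht).add hP.im) ?_)
  refine (ht.prodMk hY).contDiff_comp (g := fun p : ℝ × ℝ => blend L p.1 p.2) ?_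
  unfold blend
  have : ContDiff ℝ 1 (fun p : ℝ × ℝ => Real.arctan p.2) :=
    Real.contDiff_arctan.comp contDiff_snd
  fun_prop

theorem locallyLipschitz_lowerMap (h : Admissible R L) : LocallyLipschitz (lowerMap R L) := by
  have ht := locallyLipschitz_leafParam h
  have hΦ := locallyLipschitz_logMap h
  refine hΦ.cexp.add (LocallyLipschitz.mul_algebra (LocallyLipschitz.ofReal
    (locallyLipschitz_ramp.comp ?_)) ?_)
  · exact ht.contDiff_comp (g := fun t : ℝ => t - 2) (by fun_prop)
  · exact (hΦ.contDiff_comp (g := fun z : ℂ => -z) (by fun_prop)).cexp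

theorem lipschitzWith_upperCoeff (R : ℝ) : LipschitzWith 1 (upperCoeff R) := by
  have h1 : LipschitzWith 1 fun z : ℂ => |z.re - 2| := LipschitzWith.of_dist_le_mul fun z w => by
    rw [NNReal.coe_one, one_mul, Real.dist_eq, dist_eq_norm]
    refine (abs_abs_sub_abs_le _ _).trans ?_
    have := abs_re_le_norm (z - w)
    simpa using this
  have h2 : LipschitzWith 1 fun z : ℂ => z.im - R - 3 := LipschitzWith.of_dist_le_mul fun z w => by
    rw [NNReal.coe_one, one_mul, Real.dist_eq, dist_eq_norm]
    have := abs_im_le_norm (z - w)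
    simpa using this
  have := (h1.max h2).const_min 1
  rw [max_self] at this
  exact this

theorem locallyLipschitz_upperMap (R : ℝ) : LocallyLipschitz (upperMap R) := by
  refine (LocallyLipschitz.id.cexp).add (LocallyLipschitz.mul_algebra
    (lipschitzWith_upperCoeff R).locallyLipschitz.ofReal ?_)
  exact (LocallyLipschitz.id.contDiff_comp (g := fun z : ℂ => -z) (by fun_prop)).cexp

/-! ### Distortion of the pieces -/

/-- The distortion bound of the logarithmic coordinate. -/
def logDistortion : ℝ := 3 * 11 ^ 2 / (1 / 24) ^ 2 * (3 * 8 ^ 2 / 1 ^ 2 * (3 * 3 ^ 2 / 1 ^ 2))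

theorem leafCoord_le (h : Admissible R L) {z : ℂ} (hz : z.re ≤ L) : leafCoord R L z ≤ L := by
  have hD := half_le_sub_stereoCos h (pencilCoord R L z)
  have hL := h.pos'
  have : 0 ≤ L * (L - z.re) * (L - R * stereoCos (pencilCoord R L z))⁻¹ :=
    mul_nonneg (mul_nonneg hL.le (by linarith)) (inv_nonneg.2 (by linarith))
  rw [leafCoord]; linarith

theorem pencilCoord_nonneg (h : Admissible R L) {z : ℂ} (hz : 0 ≤ z.im) :
    0 ≤ pencilCoord R L z := div_nonneg hz (cutHeight_pos h _).le

theorem pencilCoord_le_one (h : Admissible R L) {z : ℂ} (hz : z.im ≤ cutHeight R L z.re) :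
    pencilCoord R L z ≤ 1 := (div_le_one (cutHeight_pos h _)).2 hz

theorem leafParam_eventuallyEq (h : Admissible R L) {z : ℂ} (hz : 0 < leafCoord R L z) :
    leafParam R L =ᶠ[𝓝 z] leafCoord R L := by
  filter_upwards [(locallyLipschitz_leafCoord h).continuous.continuousAt.eventually_const_lt hz]
    with w hw
  exact max_eq_left (le_of_lt hw)

/-- The intermediate coordinates are (x, LY) and (t, LY). Carrying LY instead of Y makes both
coordinates scale like L, so the derivative bounds do not depend on d. -/
theorem exists_distortion_logMap (h : Admissible R L) {z : ℂ} (hx0 : 0 < z.re) (hx : z.re ≤ L)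
    (hxc : z.re ≠ L - R) (hy0 : 0 ≤ z.im) (hy : z.im ≤ cutHeight R L z.re)
    (hl : 0 < leafCoord R L z) (h1 : leafCoord R L z ≠ 1) (h2 : leafCoord R L z ≠ 2)
    (h3 : leafCoord R L z ≠ L - R) :
    ∃ M : ℂ →L[ℝ] ℂ, HasFDerivAt (logMap R L) M z ∧ HasDistortionLE logDistortion M := by
  have hL := h.pos'
  have hcancel : ∀ Y : ℝ, L * Y / L = Y := fun Y => by field_simp
  obtain ⟨M₁, hM₁, hd₁⟩ := exists_distortion_pencil h hx0 hxc hy0 hy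
  have hY0 := pencilCoord_nonneg h hy0
  have hY1 := pencilCoord_le_one h hy
  obtain ⟨M₂, hM₂, hd₂⟩ := exists_distortion_leaf (R := R) h
    (w := ⟨z.re, L * pencilCoord R L z⟩) hx0.le hx
    (by simpa only [hcancel] using hY0) (by simpa only [hcancel] using hY1)
  have hM₂₁ := hM₂.comp z hM₁
  have e21 : (fun u : ℂ => (⟨L - L * (L - u.re) * (L - R * stereoCos (u.im / L))⁻¹, u.im⟩ : ℂ)) ∘
      (fun w : ℂ => (⟨w.re, L * pencilCoord R L w⟩ : ℂ)) =
      fun w => (⟨leafCoord R L w, L * pencilCoord R L w⟩ : ℂ) := by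
    funext w
    simp only [Function.comp, hcancel, leafCoord]
  rw [e21] at hM₂₁
  obtain ⟨M₃, hM₃, hd₃⟩ := exists_distortion_logModel (R := R) h
    (w := ⟨leafCoord R L z, L * pencilCoord R L z⟩) hl (leafCoord_le h hx) h1 h2 h3
    (by simpa only [hcancel] using hY0) (by simpa only [hcancel] using hY1)
  refine ⟨_, (hM₃.comp z hM₂₁).congr_of_eventuallyEq ?_, hd₃.comp (hd₂.comp hd₁)⟩
  filter_upwards [leafParam_eventuallyEq h hl] with w hw
  simp only [Function.comp, hcancel, logMap, hw]

/-- The derivative is multiplication by exp z - η exp(-z) plus an error of size e^(-x) from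
differentiating η. For x ≥ 1, e^x - e^(-x) ≥ 5e^(-x), because e² > 6. -/
theorem exists_distortion_exp_add {η : ℂ → ℝ} {A : ℂ →L[ℝ] ℝ} {z : ℂ} (hη : HasFDerivAt η A z)
    (hA : ‖A‖ ≤ 1) (h0 : 0 ≤ η z) (h1 : η z ≤ 1) (hz : 1 ≤ z.re) :
    ∃ M : ℂ →L[ℝ] ℂ, HasFDerivAt (fun w => exp w + (η w : ℂ) * exp (-w)) M z ∧
      HasDistortionLE 8 M := by
  have hη' : HasFDerivAt (fun w => (η w : ℂ)) (ofRealCLM.comp A) z :=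
    ofRealCLM.hasFDerivAt.comp z hη
  have he : HasFDerivAt (fun w : ℂ => exp w) (exp z • (1 : ℂ →L[ℝ] ℂ)) z :=
    (hasDerivAt_exp z).complexToReal_fderiv
  have he' : HasFDerivAt (fun w : ℂ => exp (-w)) ((exp (-z) * -1) • (1 : ℂ →L[ℝ] ℂ)) z :=
    ((hasDerivAt_id z).neg.cexp).complexToReal_fderiv
  refine ⟨_, he.add (hη'.mul he'), ?_⟩
  have hnorm : ∀ v : ℂ, ‖v‖ = 1 → ‖exp (-z) * (A v : ℂ)‖ ≤ Real.exp (-z.re) := by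
    intro v hv
    rw [norm_mul, norm_exp, neg_re, norm_real]
    have := A.le_of_opNorm_le hA v
    rw [hv] at this
    nlinarith [Real.exp_pos (-z.re)]
  refine HasDistortionLE.of_near_complexLinear (a := exp z - η z * exp (-z))
    (r := Real.exp (-z.re)) ?_ ?_ ?_
  · have h3 : ‖exp z‖ - ‖(η z : ℂ) * exp (-z)‖ ≤ ‖exp z - η z * exp (-z)‖ := norm_sub_norm_le _ _
    rw [norm_mul, norm_exp, norm_exp, norm_real, Real.norm_of_nonneg h0, neg_re] at h3
    have h4 : Real.exp z.re * Real.exp (-z.re) = 1 := by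
      rw [← Real.exp_add]; simp
    have h5 : 2.7 ≤ Real.exp z.re := by
      have := Real.exp_le_exp.2 hz
      linarith [Real.exp_one_gt_d9]
    nlinarith [Real.exp_pos (-z.re)]
  · convert hnorm 1 (by simp) using 2
    simp
  · convert hnorm I (by simp) using 2
    simp; ring

theorem exists_distortion_of_hasDerivAt {f : ℂ → ℂ} {a z : ℂ} (h : HasDerivAt f a z) :
    ∃ M : ℂ →L[ℝ] ℂ, HasFDerivAt f M z ∧ HasDistortionLE 2 M :=
  ⟨_, h.complexToReal_fderiv, hasDistortionLE_of_complexLinear (a := a) fun v => by simp⟩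

theorem norm_reCLM_le : ‖reCLM‖ ≤ 1 :=
  ContinuousLinearMap.opNorm_le_bound _ zero_le_one fun z => by
    simpa using abs_re_le_norm z

theorem logMap_re_of_two_le {z : ℂ} (h2 : 2 ≤ leafParam R L z) :
    (logMap R L z).re = leafParam R L z := by
  simp [logMap, logModel, cutLog_of_two_le h2]

/-- Locally the map factors as F ∘ Φ. For t < 2, F = exp. For t > 2 the correction vanishes, Re Φ =
t, and the coefficient becomes a function of Φ alone. -/
theorem exists_distortion_lowerMap (h : Admissible R L) {z : ℂ} (hx0 : 0 < z.re) (hx : z.re ≤ L)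
    (hxc : z.re ≠ L - R) (hy0 : 0 ≤ z.im) (hy : z.im ≤ cutHeight R L z.re)
    (hl : 0 < leafCoord R L z) (h1 : leafCoord R L z ≠ 1) (h2 : leafCoord R L z ≠ 2)
    (h3 : leafCoord R L z ≠ 3) (h4 : leafCoord R L z ≠ L - R) :
    ∃ M : ℂ →L[ℝ] ℂ, HasFDerivAt (lowerMap R L) M z ∧
      HasDistortionLE (8 * logDistortion) M := by
  obtain ⟨M, hM, hd⟩ := exists_distortion_logMap h hx0 hx hxc hy0 hy hl h1 h2 h4
  have hcont := (locallyLipschitz_leafParam h).continuous.continuousAt (x := z)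
  have hz : leafParam R L z = leafCoord R L z := max_eq_left hl.le
  suffices ∃ F : ℂ → ℂ, lowerMap R L =ᶠ[𝓝 z] F ∘ logMap R L ∧
      ∃ N : ℂ →L[ℝ] ℂ, HasFDerivAt F N (logMap R L z) ∧ HasDistortionLE 8 N by
    obtain ⟨F, hF, N, hN, hdN⟩ := this
    exact ⟨_, (hN.comp z hM).congr_of_eventuallyEq hF, hdN.comp hd⟩
  rcases lt_or_gt_of_ne h2 with h2 | h2
  · refine ⟨exp, ?_, ?_⟩
    · filter_upwards [hcont.eventually_lt_const (hz.trans_lt h2)] with w hw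
      simp [lowerMap, ramp_of_nonpos (sub_nonpos.2 (le_of_lt hw))]
    · obtain ⟨N, hN, hdN⟩ := exists_distortion_of_hasDerivAt (hasDerivAt_exp (logMap R L z))
      exact ⟨N, hN, hdN.mono two_pos (by norm_num)⟩
  · have hre : (logMap R L z).re = leafCoord R L z := by
      rw [logMap_re_of_two_le (hz ▸ h2.le), hz]
    refine ⟨fun w => exp w + ((ramp (w.re - 2) : ℝ) : ℂ) * exp (-w), ?_, ?_⟩
    · filter_upwards [hcont.eventually_const_lt (hz ▸ h2)] with w hw
      simp only [lowerMap, Function.comp, logMap_re_of_two_le (le_of_lt hw)]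
    · suffices ∃ A : ℂ →L[ℝ] ℝ, HasFDerivAt (fun w : ℂ => ramp (w.re - 2)) A (logMap R L z) ∧
          ‖A‖ ≤ 1 by
        obtain ⟨A, hA, hA1⟩ := this
        exact exists_distortion_exp_add hA hA1 (ramp_nonneg _) (ramp_le_one _)
          (by rw [hre]; linarith)
      have hc : ContinuousAt (fun w : ℂ => w.re) (logMap R L z) := continuous_re.continuousAt
      rcases lt_or_gt_of_ne h3 with h3 | h3
      · refine ⟨reCLM, ?_, norm_reCLM_le⟩
        refine ((reCLM.hasFDerivAt (x := logMap R L z)).sub_const 2).congr_of_eventuallyEq ?_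
        filter_upwards [hc.eventually_const_lt (hre.symm ▸ h2),
          hc.eventually_lt_const (hre.symm ▸ h3)] with w hw hw'
        rw [ramp_of_mem (by linarith) (by linarith)]; rfl
      · refine ⟨0, ?_, by simp⟩
        refine (hasFDerivAt_const (1 : ℝ) _).congr_of_eventuallyEq ?_
        filter_upwards [hc.eventually_const_lt (hre.symm ▸ h3)] with w hw
        exact ramp_of_one_le (by linarith)

theorem upperCoeff_nonneg (R : ℝ) (z : ℂ) : 0 ≤ upperCoeff R z :=
  le_min zero_le_one (le_max_of_le_left (abs_nonneg _))

theorem upperCoeff_le_one (R : ℝ) (z : ℂ) : upperCoeff R z ≤ 1 := min_le_left _ _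

theorem upperCoeff_of_re_le_one {z : ℂ} (hz : z.re ≤ 1) : upperCoeff R z = 1 := by
  refine min_eq_left (le_max_of_le_left ?_)
  rw [abs_of_nonpos (by linarith)]; linarith

theorem upperCoeff_of_three_le_re {z : ℂ} (hz : 3 ≤ z.re) : upperCoeff R z = 1 := by
  refine min_eq_left (le_max_of_le_left ?_)
  rw [abs_of_nonneg (by linarith)]; linarith

theorem two_mul_cosh (z : ℂ) : 2 * cosh z = exp z + exp (-z) := by
  rw [cosh]; ring

theorem upperMap_of_coeff_eq_one {z : ℂ} (hz : upperCoeff R z = 1) :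
    upperMap R z = 2 * cosh z := by
  rw [upperMap, hz, two_mul_cosh]; simp

/-- Rademacher's theorem handles the corners of η. Where Re z < 1 the perturbation estimate is
unavailable, but there the map is the holomorphic 2 cosh. -/
theorem ae_exists_distortion_upperMap (R : ℝ) :
    ∀ᵐ z : ℂ, ∃ M : ℂ →L[ℝ] ℂ, HasFDerivAt (upperMap R) M z ∧ HasDistortionLE 8 M := by
  filter_upwards [(lipschitzWith_upperCoeff R).ae_differentiableAt (μ := volume)] with z hz
  rcases lt_or_ge z.re 1 with h | h
  · obtain ⟨M, hM, hd⟩ := exists_distortion_of_hasDerivAt ((hasDerivAt_cosh z).const_mul 2)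
    refine ⟨M, hM.congr_of_eventuallyEq ?_, hd.mono two_pos (by norm_num)⟩
    filter_upwards [continuous_re.continuousAt.eventually_lt_const h] with w hw
    exact upperMap_of_coeff_eq_one (upperCoeff_of_re_le_one (le_of_lt hw))
  · refine exists_distortion_exp_add hz.hasFDerivAt ?_ (upperCoeff_nonneg R z)
      (upperCoeff_le_one R z) h
    simpa using norm_fderiv_le_of_lipschitz ℝ (lipschitzWith_upperCoeff R) (x₀ := z)

/-! ### Null sets -/

/-- Fubini: each vertical slice has at most one point. -/
theorem volume_eq_zero_of_graph {S : Set ℂ} (hS : MeasurableSet S)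
    (h : ∀ z ∈ S, ∀ w ∈ S, z.re = w.re → z.im = w.im) : volume S = 0 := by
  have hp := volume_preserving_equiv_real_prod.symm
  rw [← hp.measure_preimage hS.nullMeasurableSet, Measure.volume_eq_prod,
    Measure.measure_prod_null (hp.measurable hS)]
  refine .of_forall fun x => ?_
  refine Set.Subsingleton.measure_zero ?_ _
  intro y hy y' hy'
  exact h _ hy _ hy' rfl

theorem volume_re_eq (a : ℝ) : volume {z : ℂ | z.re = a} = 0 := by
  have hp := volume_preserving_equiv_real_prod.symm
  have hS : MeasurableSet {z : ℂ | z.re = a} :=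
    (isClosed_singleton.preimage continuous_re).measurableSet
  rw [← hp.measure_preimage hS.nullMeasurableSet, Measure.volume_eq_prod]
  have : (⇑measurableEquivRealProd.symm ⁻¹' {z : ℂ | z.re = a}) = {a} ×ˢ (univ : Set ℝ) := by
    ext p; simp [measurableEquivRealProd]
  rw [this, Measure.prod_prod]; simp

theorem volume_im_eq (a : ℝ) : volume {z : ℂ | z.im = a} = 0 :=
  volume_eq_zero_of_graph (isClosed_singleton.preimage continuous_im).measurableSet
    fun _ hz _ hw _ => Eq.trans hz (Eq.symm hw)

theorem stereoCos_injOn {Y Y' : ℝ} (h0 : 0 ≤ Y) (h0' : 0 ≤ Y') (h : stereoCos Y = stereoCos Y') :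
    Y = Y' := by
  rw [stereoCos, stereoCos, div_eq_div_iff (by positivity) (by positivity)] at h
  have : Y ^ 2 = Y' ^ 2 := by linarith
  exact (pow_left_inj₀ h0 h0' two_ne_zero).1 this

/-- For fixed Re z, since τ ≠ L, the equation determines `stereoCos` of the slope, hence the slope
and Im z: the leaf is a graph. -/
theorem volume_leafCoord_eq (h : Admissible R L) {τ : ℝ} (hτ : τ < L) :
    volume {z : ℂ | 0 ≤ z.im ∧ leafCoord R L z = τ} = 0 := by
  have hcont := (locallyLipschitz_leafCoord h).continuous
  refine volume_eq_zero_of_graph ((isClosed_le continuous_const continuous_im).inter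
    (isClosed_eq hcont continuous_const)).measurableSet ?_
  rintro z ⟨hz0, hz⟩ w ⟨hw0, hw⟩ hzw
  have hne := sub_stereoCos_ne_zero h
  have e1 : ∀ u : ℂ, leafCoord R L u = τ →
      L * (L - u.re) = (L - τ) * (L - R * stereoCos (pencilCoord R L u)) := by
    intro u hu
    rw [leafCoord, ← div_eq_mul_inv] at hu
    have := hne (pencilCoord R L u)
    have h5 : L * (L - u.re) / (L - R * stereoCos (pencilCoord R L u)) = L - τ := by linarith
    rwa [div_eq_iff this] at h5
  have h1 := e1 z hz
  have h2 := e1 w hw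
  rw [hzw, h2] at h1
  have h3 := mul_left_cancel₀ (by linarith : L - τ ≠ 0) h1
  have h4 : stereoCos (pencilCoord R L z) = stereoCos (pencilCoord R L w) :=
    mul_left_cancel₀ h.pos.ne' (by linarith)
  have h5 := stereoCos_injOn (pencilCoord_nonneg h hz0) (pencilCoord_nonneg h hw0) h4
  rw [pencilCoord, pencilCoord, hzw] at h5
  exact (div_left_inj' (cutHeight_pos h w.re).ne').1 h5

theorem volume_im_eq_cutHeight (R L : ℝ) : volume {z : ℂ | z.im = cutHeight R L z.re} = 0 := by
  refine volume_eq_zero_of_graph (isClosed_eq continuous_im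
    (locallyLipschitz_cutHeight.continuous.comp continuous_re)).measurableSet ?_
  intro z hz w hw hzw
  change _ = _ at hz hw
  rw [hz, hw, hzw]

/-! ### Boundary values -/

theorem cutHeight_zero (h : Admissible R L) : cutHeight R L 0 = R := by
  rw [cutHeight, max_self, min_eq_left (by linarith [h.four_le]), add_zero]

theorem cutHeight_of_le {x : ℝ} (h0 : 0 ≤ x) (h1 : x ≤ L - R) : cutHeight R L x = R + x := by
  rw [cutHeight, max_eq_left h0, min_eq_left h1]

theorem cutHeight_of_ge {x : ℝ} (h0 : 0 ≤ x) (h1 : L - R ≤ x) : cutHeight R L x = L := by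
  rw [cutHeight, max_eq_left h0, min_eq_right h1]; ring

theorem cutHeight_sub_le {x : ℝ} (h0 : 0 ≤ x) : cutHeight R L x ≤ R + x := by
  rw [cutHeight, max_eq_left h0]; linarith [min_le_left x (L - R)]

theorem leafParam_of_cut (h : Admissible R L) {z : ℂ} (h0 : 0 ≤ z.re)
    (hz : z.im = cutHeight R L z.re) : leafParam R L z = z.re ∧ pencilCoord R L z = 1 := by
  have h1 : pencilCoord R L z = 1 := by
    rw [pencilCoord, hz, div_self (cutHeight_pos h _).ne']
  refine ⟨?_, h1⟩
  have hL := h.pos'.ne'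
  rw [leafParam, leafCoord, h1, stereoCos]
  have : L - L * (L - z.re) * (L - R * ((1 - 1 ^ 2) / (1 + 1 ^ 2)))⁻¹ = z.re := by
    norm_num
    field_simp
    ring
  rw [this, max_eq_left h0]

theorem blend_one (h : Admissible R L) (t : ℝ) : blend L t 1 = 1 := by
  have := h.pos'.ne'
  have := Real.pi_ne_zero
  rw [blend, Real.arctan_one]
  field_simp
  ring

theorem logMap_of_cut (h : Admissible R L) {z : ℂ} (h0 : 0 ≤ z.re)
    (hz : z.im = cutHeight R L z.re) : logMap R L z = z + cutLog z.re := by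
  obtain ⟨h1, h2⟩ := leafParam_of_cut h h0 hz
  rw [logMap, h1, h2, logModel, blend_one h, mul_one, ← hz]
  rfl

/-- Modulo 2π, -2R is 2π/3; the integer d contributes only full turns. -/
theorem exp_mul_spiral {d : ℕ} (hR : R = d * Real.pi - Real.pi / 3) {z : ℂ}
    (hz : z.im = R + z.re) : exp z * spiral z.re = exp (-z) := by
  have h1 : (⟨-2 * z.re, 2 * Real.pi / 3 - 2 * z.re⟩ : ℂ) = -2 * z + d * (2 * Real.pi * I) := by
    apply Complex.ext
    · simp
    · simp [hz, hR]; ring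
  rw [spiral, h1, ← exp_add, ← add_assoc, exp_add, exp_nat_mul, exp_two_pi_mul_I, one_pow,
    mul_one]
  congr 1; ring

theorem lowerMap_eq_upperMap (h : Admissible R L) {d : ℕ} (hR : R = d * Real.pi - Real.pi / 3)
    {z : ℂ} (h0 : 0 ≤ z.re) (hz : z.im = cutHeight R L z.re) :
    lowerMap R L z = upperMap R z := by
  have ht := (leafParam_of_cut h h0 hz).1
  have hc := cutHeight_sub_le (R := R) (L := L) h0
  rw [lowerMap, logMap_of_cut h h0 hz, ht, upperMap]
  rcases le_total z.re 2 with h2 | h2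
  · have hz' : z.im = R + z.re := by
      rw [hz, cutHeight_of_le h0 (by linarith [h.four_le])]
    -- On the cut Im z - R ≤ Re z, so the second entry of the maximum never exceeds |Re z - 2|.
    have hη : upperCoeff R z = ramp (2 - z.re) := by
      rw [upperCoeff, abs_of_nonpos (by linarith), max_eq_left (by linarith), ramp,
        max_eq_right (le_min zero_le_one (by linarith))]
      ring_nf
    rw [ramp_of_nonpos (by linarith), exp_add, exp_cutLog h0, cutFactor, hη, mul_add,
      mul_left_comm, exp_mul_spiral hR hz']
    simp
  · have hη : upperCoeff R z = ramp (z.re - 2) := by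
      rw [upperCoeff, abs_of_nonneg (by linarith), max_eq_left (by linarith), ramp,
        max_eq_right (le_min zero_le_one (by linarith))]
    rw [cutLog_of_two_le h2, hη, add_zero]

theorem exp_two_arctan (Y : ℝ) : exp (⟨0, 2 * Real.arctan Y⟩ : ℂ) =
    ⟨stereoCos Y, 2 * Y / (1 + Y ^ 2)⟩ := by
  have hs : (0 : ℝ) < 1 + Y ^ 2 := by positivity
  have hsq := Real.sq_sqrt hs.le
  apply Complex.ext
  · rw [exp_re]
    simp only [Real.exp_zero, one_mul, Real.cos_two_mul, Real.cos_arctan, stereoCos]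
    rw [div_pow, hsq]
    field_simp
    ring
  · rw [exp_im]
    simp only [Real.exp_zero, one_mul, Real.sin_two_mul, Real.cos_arctan, Real.sin_arctan]
    rw [mul_assoc, div_mul_div_comm, ← sq, hsq]
    ring

theorem sq_norm_of_norm_eq {z : ℂ} (hz : ‖z‖ = R) : z.re ^ 2 + z.im ^ 2 = R ^ 2 := by
  rw [← Complex.sq_norm_eq, hz]

/-- Lines of the pencil pass through -R, so at angle θ on the circle Y = tan(θ/2) and `stereoCos` Y
= cos θ. Hence t = 0 and Φ = i(R + π/3)(4/π)(θ/2) = 2diθ. -/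
theorem lowerMap_of_norm_eq (h : Admissible R L) {d : ℕ} (hR : R = d * Real.pi - Real.pi / 3)
    {z : ℂ} (h0 : 0 ≤ z.re) (hz : ‖z‖ = R) :
    lowerMap R L z = (z / (R : ℂ)) ^ (2 * d) := by
  have hRpos := h.pos
  have hL := h.pos'
  have hsq := sq_norm_of_norm_eq hz
  have hxR : z.re ≤ R := by rw [← hz]; exact re_le_norm z
  have hc : cutHeight R L z.re = R + z.re := cutHeight_of_le h0 (by linarith [h.le_half])
  have hY : pencilCoord R L z = z.im / (R + z.re) := by rw [pencilCoord, hc]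
  obtain ⟨Y, hYd⟩ : ∃ Y, Y = z.im / (R + z.re) := ⟨_, rfl⟩
  have hsum : 0 < R + z.re := by linarith
  have hden : 1 + Y ^ 2 = 2 * R / (R + z.re) := by
    rw [hYd]; field_simp; linarith
  have hk : stereoCos Y = z.re / R := by
    rw [stereoCos, hden, show 1 - Y ^ 2 = 2 - (1 + Y ^ 2) by ring, hden]
    field_simp; ring
  have hs : 2 * Y / (1 + Y ^ 2) = z.im / R := by
    rw [hden, hYd]; field_simp
  have hleaf : leafParam R L z = 0 := by
    have hne : L - z.re ≠ 0 := by linarith [h.four_le]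
    rw [leafParam, leafCoord, hY, ← hYd, hk, mul_div_cancel₀ _ hRpos.ne', mul_assoc,
      mul_inv_cancel₀ hne]
    simp
  have hlog : logMap R L z = ((2 * d : ℕ) : ℂ) * (⟨0, 2 * Real.arctan Y⟩ : ℂ) := by
    rw [logMap, hleaf, hY, ← hYd, logModel, cutLog_zero, cutHeight_zero h, blend, hR]
    have := Real.pi_ne_zero
    apply Complex.ext
    · simp
    · simp
      field_simp
      ring
  rw [lowerMap, hlog, hleaf, ramp_of_nonpos (by norm_num), exp_nat_mul, exp_two_arctan, hk, hs]
  simp only [ofReal_zero, zero_mul, add_zero]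
  congr 1
  apply Complex.ext <;> simp

theorem cosh_of_right (h : Admissible R L) {z : ℂ} (hre : z.re = L) : lowerMap R L z =
    2 * cosh z := by
  have hL := h.pos'
  have hleaf : leafParam R L z = L := by
    rw [leafParam, leafCoord, hre, sub_self]; simp [hL.le]
  have hc : cutHeight R L L = L := cutHeight_of_ge hL.le (by linarith [h.pos])
  have hlog : logMap R L z = z := by
    rw [logMap, hleaf, logModel, cutLog_of_two_le (by linarith [h.six_le]), blend, div_self hL.ne',
      hc, pencilCoord, hre, hc]
    apply Complex.ext
    · simp [hre]
    · simp; field_simp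
  rw [lowerMap, hlog, hleaf, ramp_of_one_le (by linarith [h.six_le]), two_mul_cosh]
  simp

theorem lowerMap_of_im_eq_zero {z : ℂ} (hz : z.im = 0) :
    starRingEnd ℂ (lowerMap R L z) = lowerMap R L z := by
  have hlog : starRingEnd ℂ (logMap R L z) = logMap R L z := by
    rw [conj_eq_iff_im, logMap, logModel, pencilCoord, hz]
    simp [blend]
  simp only [lowerMap, map_add, map_mul, ← exp_conj, map_neg, hlog, conj_ofReal]

/-- Over the sloping part of the cut, positivity is the condition |z| > R. Farther right it follows
from R ≤ L - R < Re z. -/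
theorem leafCoord_pos (h : Admissible R L) {z : ℂ} (h0 : 0 < z.re)
    (hz : R < ‖z‖) : 0 < leafCoord R L z := by
  have hRpos := h.pos
  rw [leafCoord_pos_iff h]
  rcases le_or_gt z.re (L - R) with hx | hx
  · rw [pencilCoord, cutHeight_of_le h0.le hx, stereoCos]
    have hsq : R ^ 2 < z.re ^ 2 + z.im ^ 2 := by
      rw [← Complex.sq_norm_eq]; gcongr
    have hpos : 0 < R + z.re := by linarith
    have e : (1 - (z.im / (R + z.re)) ^ 2) / (1 + (z.im / (R + z.re)) ^ 2) =
        ((R + z.re) ^ 2 - z.im ^ 2) / ((R + z.re) ^ 2 + z.im ^ 2) := by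
      field_simp
    rw [e, ← mul_div_assoc, div_lt_iff₀ (by positivity)]
    nlinarith
  · have := stereoCos_le_one (pencilCoord R L z)
    nlinarith [h.le_half]

/-! ### Extension by symmetry -/

/-- The reflection of the plane to the closed first quadrant. -/
def foldQuadrant (z : ℂ) : ℂ := ⟨|z.re|, |z.im|⟩

/-- The reflection of a value in the first quadrant to the quadrant of `z`. -/
def unfoldQuadrant (z w : ℂ) : ℂ := if 0 ≤ z.re * z.im then w else starRingEnd ℂ w

theorem unfoldQuadrant_apply_fold {f : ℂ → ℂ} (h1 : ∀ z, f (-z) = f z)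
    (h2 : ∀ z, f (starRingEnd ℂ z) = starRingEnd ℂ (f z)) (z : ℂ) :
    unfoldQuadrant z (f (foldQuadrant z)) = f z := by
  unfold unfoldQuadrant
  rcases le_or_gt 0 z.re with hx | hx <;> rcases le_or_gt 0 z.im with hy | hy
  · have e : foldQuadrant z = z := by
      rw [foldQuadrant, abs_of_nonneg hx, abs_of_nonneg hy]
    rw [e, if_pos (mul_nonneg hx hy)]
  · have e : foldQuadrant z = starRingEnd ℂ z := by
      rw [foldQuadrant, abs_of_nonneg hx, abs_of_neg hy]; rfl
    rw [e, h2]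
    split_ifs with hc
    · have hx0 : z.re = 0 := by nlinarith
      rw [← h2, ← h1 z]
      congr 1
      apply Complex.ext <;> simp [hx0]
    · simp
  · have e : foldQuadrant z = -starRingEnd ℂ z := by
      rw [foldQuadrant, abs_of_neg hx, abs_of_nonneg hy]
      apply Complex.ext <;> simp
    rw [e, h1, h2]
    split_ifs with hc
    · have hy0 : z.im = 0 := by nlinarith
      rw [← h2]
      congr 1
      apply Complex.ext <;> simp [hy0]
    · simp
  · have e : foldQuadrant z = -z := by
      rw [foldQuadrant, abs_of_neg hx, abs_of_neg hy]; rfl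
    rw [e, h1, if_pos (mul_nonneg_of_nonpos_of_nonpos hx.le hy.le)]

theorem norm_foldQuadrant (z : ℂ) : ‖foldQuadrant z‖ = ‖z‖ := by
  have : ‖foldQuadrant z‖ ^ 2 = ‖z‖ ^ 2 := by
    rw [Complex.sq_norm_eq, Complex.sq_norm_eq]; simp [foldQuadrant]
  exact (pow_left_inj₀ (norm_nonneg _) (norm_nonneg _) two_ne_zero).1 this

/-- The interpolating map outside the disc, in the closed first quadrant. -/
def outerMap (R L : ℝ) (z : ℂ) : ℂ :=
  if z.im ≤ cutHeight R L z.re then lowerMap R L z else upperMap R z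

/-- The interpolating map in the closed first quadrant. -/
def quadrantMap (R L : ℝ) (n : ℕ) (z : ℂ) : ℂ :=
  if ‖z‖ ≤ R then (z / (R : ℂ)) ^ n else outerMap R L z

/-- The interpolating map, extended from the first quadrant to the plane by reflection. -/
def interpMap (R L : ℝ) (n : ℕ) (z : ℂ) : ℂ :=
  unfoldQuadrant z (quadrantMap R L n (foldQuadrant z))

theorem interpMap_neg (n : ℕ) (z : ℂ) : interpMap R L n (-z) = interpMap R L n z := by
  simp [interpMap, unfoldQuadrant, foldQuadrant]

theorem upperMap_of_re_eq_zero {z : ℂ} (hz : z.re = 0) :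
    starRingEnd ℂ (upperMap R z) = upperMap R z := by
  rw [upperMap_of_coeff_eq_one (upperCoeff_of_re_le_one (by rw [hz]; exact zero_le_one)),
    map_mul, ← cosh_conj]
  have : starRingEnd ℂ z = -z := by apply Complex.ext <;> simp [hz]
  rw [this, cosh_neg, map_ofNat]

/-- Reality on the axes makes the reflected copies agree there, giving both the conjugation symmetry
and continuity across the axes. -/
theorem quadrantMap_real (h : Admissible R L) (d : ℕ) {z : ℂ} (hy : 0 ≤ z.im)
    (hz : z.re = 0 ∨ z.im = 0) :
    starRingEnd ℂ (quadrantMap R L (2 * d) z) = quadrantMap R L (2 * d) z := by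
  rw [quadrantMap]
  split_ifs with hn
  · rw [map_pow, map_div₀, conj_ofReal]
    rcases hz with hz | hz
    · have : starRingEnd ℂ z = -z := by apply Complex.ext <;> simp [hz]
      rw [this, neg_div, pow_mul, pow_mul, neg_sq]
    · rw [conj_eq_iff_im.2 hz]
  · rw [outerMap]
    rcases hz with hz | hz
    · have him : R < z.im := by
        rw [not_le] at hn
        have : ‖z‖ = z.im := by
          have : z = (z.im : ℂ) * I := by apply Complex.ext <;> simp [hz]
          rw [this, norm_mul, norm_I, norm_real, mul_one, Real.norm_of_nonneg hy]; simp
        linarith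
      rw [hz, cutHeight_zero h, if_neg (not_le.2 him), upperMap_of_re_eq_zero hz]
    · rw [hz, if_pos (cutHeight_pos h _).le, lowerMap_of_im_eq_zero hz]

theorem interpMap_conj (h : Admissible R L) (d : ℕ) (z : ℂ) :
    interpMap R L (2 * d) (starRingEnd ℂ z) = starRingEnd ℂ (interpMap R L (2 * d) z) := by
  have e : foldQuadrant (starRingEnd ℂ z) = foldQuadrant z := by simp [foldQuadrant]
  rw [interpMap, interpMap, e, unfoldQuadrant, unfoldQuadrant, conj_re, conj_im, mul_neg]
  rcases lt_trichotomy (z.re * z.im) 0 with hc | hc | hc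
  · rw [if_pos (by linarith), if_neg (not_le.2 hc), conj_conj]
  · rw [hc, neg_zero, if_pos le_rfl, quadrantMap_real h d (abs_nonneg _)]
    rcases mul_eq_zero.1 hc with h0 | h0
    · exact Or.inl (by simp [foldQuadrant, h0])
    · exact Or.inr (by simp [foldQuadrant, h0])
  · rw [if_neg (by linarith), if_pos hc.le]

/-! ### Gluing across the cut, the circle and the axes. -/

theorem locallyLipschitz_foldQuadrant : LocallyLipschitz foldQuadrant :=
  (LocallyLipschitz.id.re.abs_real).complexMk (LocallyLipschitz.id.im.abs_real)

theorem locallyLipschitz_outerMap_fold (h : Admissible R L) {d : ℕ}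
    (hR : R = d * Real.pi - Real.pi / 3) :
    LocallyLipschitz fun z => outerMap R L (foldQuadrant z) := by
  have hf := locallyLipschitz_foldQuadrant
  have hc : Continuous fun z => cutHeight R L (foldQuadrant z).re :=
    locallyLipschitz_cutHeight.continuous.comp (continuous_re.comp hf.continuous)
  have hi : Continuous fun z => (foldQuadrant z).im := continuous_im.comp hf.continuous
  refine LocallyLipschitz.glue (isClosed_le hi hc) (isClosed_le hc hi)
    (fun z => le_total (foldQuadrant z).im (cutHeight R L (foldQuadrant z).re))
    ((locallyLipschitz_lowerMap h).comp hf) ((locallyLipschitz_upperMap R).comp hf) ?_ ?_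
  · intro z hz
    exact if_pos hz
  · intro z hz
    change cutHeight R L (foldQuadrant z).re ≤ (foldQuadrant z).im at hz
    simp only [outerMap, Function.comp]
    split_ifs with hle
    · exact lowerMap_eq_upperMap h hR (abs_nonneg _) (le_antisymm hle hz)
    · rfl

theorem outerMap_of_norm_eq (h : Admissible R L) {d : ℕ} (hR : R = d * Real.pi - Real.pi / 3)
    {z : ℂ} (h0 : 0 ≤ z.re) (hz : ‖z‖ = R) : outerMap R L z = (z / (R : ℂ)) ^ (2 * d) := by
  have : z.im ≤ cutHeight R L z.re :=
    ((im_le_norm z).trans_eq hz).trans (le_cutHeight h _)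
  rw [outerMap, if_pos this, lowerMap_of_norm_eq h hR h0 hz]

theorem locallyLipschitz_quadrantMap_fold (h : Admissible R L) {d : ℕ}
    (hR : R = d * Real.pi - Real.pi / 3) :
    LocallyLipschitz fun z => quadrantMap R L (2 * d) (foldQuadrant z) := by
  have hf := locallyLipschitz_foldQuadrant
  refine LocallyLipschitz.glue (isClosed_le continuous_norm (continuous_const (y := R)))
    (isClosed_le (continuous_const (y := R)) continuous_norm) (fun z => le_total ‖z‖ R)
    (hf.contDiff_comp (g := fun w : ℂ => (w / (R : ℂ)) ^ (2 * d)) (by fun_prop))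
    (locallyLipschitz_outerMap_fold h hR) ?_ ?_
  · intro z hz
    exact if_pos ((norm_foldQuadrant z).trans_le hz)
  · intro z hz
    change R ≤ ‖z‖ at hz
    simp only [quadrantMap, norm_foldQuadrant]
    split_ifs with hle
    · exact (outerMap_of_norm_eq h hR (abs_nonneg _)
        ((norm_foldQuadrant z).trans (le_antisymm hle hz))).symm
    · rfl

theorem locallyLipschitz_interpMap (h : Admissible R L) {d : ℕ}
    (hR : R = d * Real.pi - Real.pi / 3) : LocallyLipschitz (interpMap R L (2 * d)) := by
  have hq := locallyLipschitz_quadrantMap_fold h hR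
  have hc : Continuous fun z : ℂ => z.re * z.im := continuous_re.mul continuous_im
  refine LocallyLipschitz.glue (isClosed_le (continuous_const (y := 0)) hc)
    (isClosed_le hc (continuous_const (y := 0))) (fun z => le_total 0 (z.re * z.im))
    hq hq.conj ?_ ?_
  · intro z hz
    exact if_pos hz
  · intro z hz
    change z.re * z.im ≤ 0 at hz
    simp only [interpMap, unfoldQuadrant]
    split_ifs with hle
    · refine (quadrantMap_real h d (abs_nonneg _) ?_).symm
      rcases mul_eq_zero.1 (le_antisymm hz hle) with h0 | h0
      · exact Or.inl (by simp [foldQuadrant, h0])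
      · exact Or.inr (by simp [foldQuadrant, h0])
    · rfl

/-! ### Prescribed values on the disc, the boundary and the imaginary axis. -/

theorem interpMap_of_norm_le (d : ℕ) {z : ℂ} (hz : ‖z‖ ≤ R) :
    interpMap R L (2 * d) z = (z / (R : ℂ)) ^ (2 * d) := by
  rw [interpMap, quadrantMap, if_pos ((norm_foldQuadrant z).trans_le hz)]
  refine unfoldQuadrant_apply_fold (f := fun z => (z / (R : ℂ)) ^ (2 * d)) (fun z => ?_)
    (fun z => ?_) z
  · rw [neg_div, pow_mul, pow_mul, neg_sq]
  · rw [map_pow, map_div₀, conj_ofReal]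

theorem two_mul_cosh_fold (z : ℂ) :
    unfoldQuadrant z (2 * cosh (foldQuadrant z)) = 2 * cosh z := by
  refine unfoldQuadrant_apply_fold (f := fun z => 2 * cosh z) (fun z => ?_) (fun z => ?_) z
  · rw [cosh_neg]
  · rw [cosh_conj, map_mul, map_ofNat]

theorem quadrantMap_of_boundary (h : Admissible R L) {d : ℕ}
    (hR : R = d * Real.pi - Real.pi / 3) {z : ℂ} (h0 : 0 ≤ z.re) (hy : z.im ≤ L)
    (hz : z.re = L ∨ z.im = L) : quadrantMap R L (2 * d) z = 2 * cosh z := by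
  have hRL : R < L := by linarith [h.four_le]
  have hn : R < ‖z‖ := by
    rcases hz with hz | hz
    · exact hRL.trans_le (hz ▸ re_le_norm z)
    · exact hRL.trans_le (hz ▸ im_le_norm z)
  rw [quadrantMap, if_neg (not_le.2 hn), outerMap]
  rcases le_or_gt (L - R) z.re with hge | hlt
  · have hc := cutHeight_of_ge h0 hge
    rw [hc, if_pos hy]
    rcases hz with hz | hz
    · exact cosh_of_right h hz
    · rw [lowerMap_eq_upperMap h hR h0 (hz.trans hc.symm)]
      exact upperMap_of_coeff_eq_one (upperCoeff_of_three_le_re (by linarith [h.four_le]))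
  · rcases hz with hz | hz
    · linarith [h.pos]
    · rw [cutHeight_of_le h0 hlt.le, if_neg (by linarith)]
      refine upperMap_of_coeff_eq_one (min_eq_left (le_max_of_le_right ?_))
      linarith [h.four_le]

theorem interpMap_of_boundary (h : Admissible R L) {d : ℕ}
    (hR : R = d * Real.pi - Real.pi / 3) {z : ℂ} (hy : |z.im| ≤ L)
    (hz : |z.re| = L ∨ |z.im| = L) : interpMap R L (2 * d) z = 2 * cosh z := by
  rw [interpMap, quadrantMap_of_boundary h hR (abs_nonneg _) hy hz, two_mul_cosh_fold]

theorem interpMap_of_imaginary (h : Admissible R L) {d : ℕ}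
    (hR : R = d * Real.pi - Real.pi / 3) {z : ℂ} (hz : z.re = 0) (hn : R ≤ ‖z‖) :
    interpMap R L (2 * d) z = 2 * cosh z := by
  have hre : (foldQuadrant z).re = 0 := by simp [foldQuadrant, hz]
  have him : (foldQuadrant z).im = ‖z‖ := by
    have : z = (z.im : ℂ) * I := by apply Complex.ext <;> simp [hz]
    rw [this, norm_mul, norm_I, norm_real, mul_one]; simp [foldQuadrant]
  have key : quadrantMap R L (2 * d) (foldQuadrant z) = upperMap R (foldQuadrant z) := by
    rw [quadrantMap, norm_foldQuadrant]
    -- The point iR lies in the closed disc, where the power is used; it is also on the circle and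
    -- the cut, so the power equals the upper map there.
    rcases hn.eq_or_lt with hn | hn
    · have hc : (foldQuadrant z).im = cutHeight R L (foldQuadrant z).re := by
        rw [hre, him, cutHeight_zero h, hn]
      rw [if_pos hn.ge, ← lowerMap_eq_upperMap h hR hre.ge hc,
        lowerMap_of_norm_eq h hR hre.ge ((norm_foldQuadrant z).trans hn.symm)]
    · rw [if_neg (not_le.2 hn), outerMap, hre, him, cutHeight_zero h, if_neg (not_le.2 hn)]
  rw [interpMap, key, upperMap_of_coeff_eq_one (upperCoeff_of_re_le_one
    (by rw [hre]; exact zero_le_one)), two_mul_cosh_fold]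

/-! ### The range -/

theorem sq_div_le_of_abs_le {p c : ℝ} (hp : |p| ≤ c) (x : ℝ) : (p * x) ^ 2 / c ^ 2 ≤ x ^ 2 := by
  have hc : 0 ≤ c := (abs_nonneg p).trans hp
  rcases hc.eq_or_lt with h0 | h0
  · rw [← h0]; simp; positivity
  · rw [div_le_iff₀ (by positivity), mul_pow, mul_comm]
    exact mul_le_mul_of_nonneg_left (sq_le_sq' (neg_le_of_abs_le hp) (le_of_abs_le hp))
      (sq_nonneg x)

/-- The closed elliptical region. -/
def closedEllipse (r : ℝ) : Set ℂ :=
  {z | z.re ^ 2 / (2 * Real.cosh r) ^ 2 + z.im ^ 2 / (2 * Real.sinh r) ^ 2 ≤ 1}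

/-- Shrinking a point toward the centre puts it in the open region. -/
theorem closedEllipse_subset_closure (r : ℝ) : closedEllipse r ⊆ closure (ellipseE r) := by
  intro z hz
  have hcont : Tendsto (fun t : ℝ => (t : ℂ) * z) (𝓝[<] 1) (𝓝 z) := by
    have : ContinuousAt (fun t : ℝ => (t : ℂ) * z) 1 := by fun_prop
    have h2 := this.tendsto.mono_left (nhdsWithin_le_nhds (s := Iio (1 : ℝ)))
    simpa using h2
  refine mem_closure_of_tendsto hcont ?_
  filter_upwards [Ioo_mem_nhdsLT (zero_lt_one (α := ℝ))] with t ht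
  change ((t : ℂ) * z).re ^ 2 / (2 * Real.cosh r) ^ 2 +
    ((t : ℂ) * z).im ^ 2 / (2 * Real.sinh r) ^ 2 < 1
  rw [re_ofReal_mul, im_ofReal_mul, mul_pow t, mul_pow t, mul_div_assoc, mul_div_assoc,
    ← mul_add]
  have ht2 : t ^ 2 < 1 := by nlinarith [ht.1, ht.2]
  have hz' : z.re ^ 2 / (2 * Real.cosh r) ^ 2 + z.im ^ 2 / (2 * Real.sinh r) ^ 2 ≤ 1 := hz
  have := mul_le_mul_of_nonneg_left hz' (sq_nonneg t)
  linarith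

theorem exp_three_le_two_mul_sinh (hL : 6 ≤ L) : Real.exp 3 ≤ 2 * Real.sinh L := by
  have h1 : Real.exp 6 ≤ Real.exp L := Real.exp_le_exp.2 hL
  have h2 : Real.exp 6 = Real.exp 3 * Real.exp 3 := by rw [← Real.exp_add]; norm_num
  have h3 : Real.exp (-L) ≤ 1 := Real.exp_le_one_iff.2 (by linarith)
  have h4 : 3 + 1 ≤ Real.exp 3 := Real.add_one_le_exp 3
  rw [Real.sinh_eq]
  nlinarith

/-- With Z = u + iv the value is ((e^u + ηe^(-u)) cos v, (e^u - ηe^(-u)) sin v), so only semiaxes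
need comparing. When η < 1 the bound u ≤ 3 leaves room, as e³ ≤ 2 sinh L. -/
theorem exp_add_mem_closedEllipse (hL : 6 ≤ L) {η : ℝ} {Z : ℂ} (h0 : 0 ≤ η) (h1 : η ≤ 1)
    (hZ : (0 ≤ Z.re ∧ Z.re ≤ L ∧ (η = 1 ∨ Z.re ≤ 3)) ∨ (η = 0 ∧ Real.exp Z.re ≤ Real.exp 3)) :
    exp Z + (η : ℂ) * exp (-Z) ∈ closedEllipse L := by
  have hsinh := exp_three_le_two_mul_sinh hL
  have hcs := Real.sinh_lt_cosh L
  have hre : (exp Z + (η : ℂ) * exp (-Z)).re =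
      (Real.exp Z.re + η * Real.exp (-Z.re)) * Real.cos Z.im := by
    rw [add_re, re_ofReal_mul, exp_re, exp_re, neg_re, neg_im, Real.cos_neg]; ring
  have him : (exp Z + (η : ℂ) * exp (-Z)).im =
      (Real.exp Z.re - η * Real.exp (-Z.re)) * Real.sin Z.im := by
    rw [add_im, im_ofReal_mul, exp_im, exp_im, neg_re, neg_im, Real.sin_neg]; ring
  suffices |Real.exp Z.re + η * Real.exp (-Z.re)| ≤ 2 * Real.cosh L ∧
      |Real.exp Z.re - η * Real.exp (-Z.re)| ≤ 2 * Real.sinh L by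
    change _ + _ ≤ (1 : ℝ)
    rw [hre, him, ← Real.cos_sq_add_sin_sq Z.im]
    exact add_le_add (sq_div_le_of_abs_le this.1 _) (sq_div_le_of_abs_le this.2 _)
  have hp := Real.exp_pos Z.re
  have hn := Real.exp_pos (-Z.re)
  rcases hZ with ⟨hu0, huL, hη⟩ | ⟨hη, hu⟩
  · have e1 : 1 ≤ Real.exp Z.re := Real.one_le_exp hu0
    have e2 : Real.exp (-Z.re) ≤ 1 := Real.exp_le_one_iff.2 (by linarith)
    have hηe : η * Real.exp (-Z.re) ≤ Real.exp (-Z.re) := by nlinarith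
    have hηe0 : 0 ≤ η * Real.exp (-Z.re) := by positivity
    constructor
    · rw [abs_of_nonneg (by positivity)]
      have : Real.cosh Z.re ≤ Real.cosh L := by
        rw [Real.cosh_le_cosh, abs_of_nonneg hu0, abs_of_nonneg (by linarith)]; exact huL
      rw [Real.cosh_eq Z.re] at this
      linarith
    · rw [abs_of_nonneg (by linarith)]
      rcases hη with hη | hη
      · have : Real.sinh Z.re ≤ Real.sinh L := Real.sinh_le_sinh.2 huL
        rw [Real.sinh_eq Z.re] at this
        rw [hη]; linarith
      · have := Real.exp_le_exp.2 hη
        linarith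
  · rw [hη, zero_mul, add_zero, sub_zero, abs_of_pos hp]
    constructor <;> linarith

theorem outerMap_mem_closedEllipse (h : Admissible R L) {z : ℂ} (h0 : 0 ≤ z.re) (hx : z.re ≤ L) :
    outerMap R L z ∈ closedEllipse L := by
  rw [outerMap]
  split_ifs
  · have ht0 := leafParam_nonneg (R := R) (L := L) z
    have htL : leafParam R L z ≤ L := max_le (leafCoord_le h hx) h.pos'.le
    refine exp_add_mem_closedEllipse h.six_le (ramp_nonneg _) (ramp_le_one _) ?_
    rcases le_total (leafParam R L z) 2 with h2 | h2
    · refine Or.inr ⟨ramp_of_nonpos (by linarith), ?_⟩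
      have e : Real.exp (logMap R L z).re =
          Real.exp (leafParam R L z) * ‖cutFactor (leafParam R L z)‖ := by
        rw [← exp_cutLog ht0, norm_exp, ← Real.exp_add]; rfl
      -- For t ≤ 2 the modulus is at most 2e² ≤ e³.
      rw [e, show (3 : ℝ) = 2 + 1 by norm_num, Real.exp_add]
      have e1 := norm_cutFactor_le ht0
      have e2 := Real.exp_le_exp.2 h2
      have e3 : 2 ≤ Real.exp 1 := by linarith [Real.exp_one_gt_d9]
      exact mul_le_mul e2 (e1.trans e3) (norm_nonneg _) (Real.exp_pos _).le
    · rw [logMap_re_of_two_le h2]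
      refine Or.inl ⟨ht0, htL, ?_⟩
      rcases le_total (leafParam R L z) 3 with h3 | h3
      · exact Or.inr h3
      · exact Or.inl (ramp_of_one_le (by linarith))
  · refine exp_add_mem_closedEllipse h.six_le (upperCoeff_nonneg R z) (upperCoeff_le_one R z)
      (Or.inl ⟨h0, hx, ?_⟩)
    rcases le_total z.re 3 with h3 | h3
    · exact Or.inr h3
    · exact Or.inl (upperCoeff_of_three_le_re h3)

theorem mem_closedEllipse_of_norm_le_one (hL : 6 ≤ L) {z : ℂ} (hz : ‖z‖ ≤ 1) :
    z ∈ closedEllipse L := by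
  have hsinh := exp_three_le_two_mul_sinh hL
  have hcs := Real.sinh_lt_cosh L
  have h4 : 3 + 1 ≤ Real.exp 3 := Real.add_one_le_exp 3
  have hn : z.re ^ 2 + z.im ^ 2 ≤ 1 := by
    rw [← Complex.sq_norm_eq]; nlinarith [norm_nonneg z]
  change _ + _ ≤ (1 : ℝ)
  have e1 : z.re ^ 2 / (2 * Real.cosh L) ^ 2 ≤ z.re ^ 2 :=
    div_le_self (sq_nonneg _) (by nlinarith)
  have e2 : z.im ^ 2 / (2 * Real.sinh L) ^ 2 ≤ z.im ^ 2 :=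
    div_le_self (sq_nonneg _) (by nlinarith)
  linarith

theorem interpMap_mem_closedEllipse (h : Admissible R L) (d : ℕ) {z : ℂ} (hx : |z.re| ≤ L) :
    interpMap R L (2 * d) z ∈ closedEllipse L := by
  have hq : quadrantMap R L (2 * d) (foldQuadrant z) ∈ closedEllipse L := by
    rw [quadrantMap]
    split_ifs with hn
    · refine mem_closedEllipse_of_norm_le_one h.six_le ?_
      rw [norm_pow, norm_div, norm_real, Real.norm_of_nonneg h.pos.le]
      exact pow_le_one₀ (div_nonneg (norm_nonneg _) h.pos.le) ((div_le_one h.pos).2 hn)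
    · exact outerMap_mem_closedEllipse h (abs_nonneg _) hx
  rw [interpMap, unfoldQuadrant]
  split_ifs
  · exact hq
  · simpa [closedEllipse] using hq

/-! ### Almost everywhere distortion -/

/-- Real differentiability with distortion at most `C`. -/
def HasDistortionAt (C : ℝ) (f : ℂ → ℂ) (z : ℂ) : Prop :=
  ∃ M : ℂ →L[ℝ] ℂ, HasFDerivAt f M z ∧ HasDistortionLE C M

theorem HasDistortionAt.congr {C : ℝ} {f g : ℂ → ℂ} {z : ℂ} (h : HasDistortionAt C g z)
    (hfg : f =ᶠ[𝓝 z] g) : HasDistortionAt C f z := by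
  obtain ⟨M, hM, hd⟩ := h
  exact ⟨M, hM.congr_of_eventuallyEq hfg, hd⟩

theorem HasDistortionAt.mono {C C' : ℝ} {f : ℂ → ℂ} {z : ℂ} (h : HasDistortionAt C f z)
    (hC : 0 < C) (hCC' : C ≤ C') : HasDistortionAt C' f z := by
  obtain ⟨M, hM, hd⟩ := h
  exact ⟨M, hM, hd.mono hC hCC'⟩

theorem HasDistortionAt.of_neg {C : ℝ} {f : ℂ → ℂ} {z : ℂ} (hf : ∀ z, f (-z) = f z)
    (h : HasDistortionAt C f (-z)) : HasDistortionAt C f z := by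
  obtain ⟨M, hM, hd⟩ := h
  have h1 := hM.comp z (hasFDerivAt_id z).neg
  have e : f ∘ Neg.neg = f := funext fun w => hf w
  rw [e] at h1
  exact ⟨_, h1, hd.neg_arg fun v => by simp⟩

theorem HasDistortionAt.of_conj {C : ℝ} {f : ℂ → ℂ} {z : ℂ}
    (hf : ∀ z, f (starRingEnd ℂ z) = starRingEnd ℂ (f z))
    (h : HasDistortionAt C f (starRingEnd ℂ z)) : HasDistortionAt C f z := by
  obtain ⟨M, hM, hd⟩ := h
  have hc : ∀ w : ℂ, HasFDerivAt (fun w : ℂ => starRingEnd ℂ w)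
      (conjCLE : ℂ →L[ℝ] ℂ) w := fun w => conjCLE.hasFDerivAt
  have h1 := (hc (f (starRingEnd ℂ z))).comp z (hM.comp z (hc z))
  have e : (fun w : ℂ => starRingEnd ℂ w) ∘ f ∘ (fun w : ℂ => starRingEnd ℂ w) = f := by
    funext w
    simp [hf]
  rw [e] at h1
  exact ⟨_, h1, hd.reflect fun v => by simp⟩

/-- The distortion bound of the interpolating map. -/
def interpDistortion : ℝ := 8 * logDistortion

theorem eight_le_interpDistortion : 8 ≤ interpDistortion := by
  unfold interpDistortion logDistortion; norm_num

theorem interpMap_eventuallyEq_quadrantMap (n : ℕ) {z : ℂ} (hx : 0 < z.re) (hy : 0 < z.im) :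
    interpMap R L n =ᶠ[𝓝 z] quadrantMap R L n := by
  filter_upwards [continuous_re.continuousAt.eventually_const_lt hx,
    continuous_im.continuousAt.eventually_const_lt hy] with w hwx hwy
  have e : foldQuadrant w = w := by
    rw [foldQuadrant, abs_of_pos hwx, abs_of_pos hwy]
  rw [interpMap, e, unfoldQuadrant, if_pos (mul_nonneg hwx.le hwy.le)]

theorem hasDerivAt_interpMap (d : ℕ) {z : ℂ} (hz : ‖z‖ < R) :
    ∃ a, HasDerivAt (interpMap R L (2 * d)) a z := by
  refine ⟨_, (((hasDerivAt_id z).div_const (R : ℂ)).pow (2 * d)).congr_of_eventuallyEq ?_⟩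
  filter_upwards [continuous_norm.continuousAt.eventually_lt_const hz] with w hw
  exact interpMap_of_norm_le d (le_of_lt hw)

/-- Discarded are the circle, the cut, the kink line Re z = L - R of the cut, and four leaves: t =
1, 2, 3 are kinks of the ramps, t = L - R that of `cutHeight`. -/
theorem ae_hasDistortionAt_quadrant (h : Admissible R L) (d : ℕ) :
    ∀ᵐ z : ℂ, 0 < z.re → z.re < L → 0 < z.im →
      HasDistortionAt interpDistortion (interpMap R L (2 * d)) z := by
  have hae : ∀ {S : Set ℂ}, volume S = 0 → ∀ᵐ z : ℂ, z ∉ S :=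
    fun hS => measure_eq_zero_iff_ae_notMem.1 hS
  have hL := h.six_le
  have hC := eight_le_interpDistortion
  filter_upwards [ae_exists_distortion_upperMap R, hae (volume_re_eq (L - R)),
    hae (volume_im_eq_cutHeight R L), hae (Measure.addHaar_sphere volume (0 : ℂ) R),
    hae (volume_leafCoord_eq h (τ := 1) (by linarith)),
    hae (volume_leafCoord_eq h (τ := 2) (by linarith)),
    hae (volume_leafCoord_eq h (τ := 3) (by linarith)),
    hae (volume_leafCoord_eq h (τ := L - R) (by linarith [h.pos]))]
    with z hup hre hcut hsph h1 h2 h3 h4 hx hxL hy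
  have hcont := locallyLipschitz_cutHeight (R := R) (L := L).continuous.comp continuous_re
  have hcut' : z.im ≠ cutHeight R L z.re := hcut
  have hsph' : ‖z‖ ≠ R := fun e => hsph (by simpa using e)
  rcases lt_or_gt_of_ne hsph' with hn | hn
  · obtain ⟨a, ha⟩ := hasDerivAt_interpMap (L := L) d hn
    exact HasDistortionAt.mono (exists_distortion_of_hasDerivAt ha) two_pos (by linarith)
  · have hev : interpMap R L (2 * d) =ᶠ[𝓝 z] outerMap R L := by
      filter_upwards [interpMap_eventuallyEq_quadrantMap (R := R) (L := L) (2 * d) hx hy,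
        continuous_norm.continuousAt.eventually_const_lt hn] with w hw hwn
      rw [hw, quadrantMap, if_neg (not_le.2 hwn)]
    rcases lt_or_gt_of_ne hcut' with hc | hc
    · have hd := exists_distortion_lowerMap h hx hxL.le hre hy.le hc.le (leafCoord_pos h hx hn)
        (fun e => h1 ⟨hy.le, e⟩) (fun e => h2 ⟨hy.le, e⟩) (fun e => h3 ⟨hy.le, e⟩)
        (fun e => h4 ⟨hy.le, e⟩)
      refine HasDistortionAt.congr hd (hev.trans ?_)
      filter_upwards [(isOpen_lt continuous_im hcont).mem_nhds hc] with w hw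
      exact if_pos (le_of_lt hw)
    · refine (HasDistortionAt.mono hup (by norm_num) hC).congr (hev.trans ?_)
      filter_upwards [(isOpen_lt hcont continuous_im).mem_nhds hc] with w hw
      exact if_neg (not_le.2 hw)

/-- The quadrant estimate is pulled back along the measure-preserving symmetries; the axes are null.
-/
theorem ae_hasDistortionAt_interpMap (h : Admissible R L) (d : ℕ) :
    ∀ᵐ z : ℂ, |z.re| < L →
      HasDistortionAt interpDistortion (interpMap R L (2 * d)) z := by
  have hq := ae_hasDistortionAt_quadrant h d
  have hneg : Measure.QuasiMeasurePreserving (fun z : ℂ => -z) :=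
    (Measure.measurePreserving_neg (volume : Measure ℂ)).quasiMeasurePreserving
  have hconj : Measure.QuasiMeasurePreserving (fun z : ℂ => starRingEnd ℂ z) :=
    (conjLIE.measurePreserving).quasiMeasurePreserving
  have hae : ∀ {S : Set ℂ}, volume S = 0 → ∀ᵐ z : ℂ, z ∉ S :=
    fun hS => measure_eq_zero_iff_ae_notMem.1 hS
  filter_upwards [hq, hneg.ae hq, hconj.ae hq, (hneg.comp hconj).ae hq, hae (volume_re_eq 0),
    hae (volume_im_eq 0)] with z h1 h2 h3 h4 hre him hz
  have hre' : z.re ≠ 0 := hre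
  have him' : z.im ≠ 0 := him
  obtain ⟨hz1, hz2⟩ := abs_lt.1 hz
  have sneg := interpMap_neg (R := R) (L := L) (2 * d)
  have sconj := interpMap_conj h d
  rcases lt_or_gt_of_ne hre' with hx | hx <;> rcases lt_or_gt_of_ne him' with hy | hy
  · exact .of_neg sneg (h2 (by simpa using hx) (by rw [neg_re]; linarith) (by simpa using hy))
  · exact .of_conj sconj (.of_neg sneg (h4 (by simpa using hx)
      (by simp only [Function.comp, neg_re, conj_re]; linarith) (by simpa using hy)))
  · exact .of_conj sconj (h3 (by simpa using hx) (by simpa using hz2) (by simpa using hy))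
  · exact h1 hx hz2 hy

/-! ### The interpolation lemma -/

/-- The ratio R/L = 1/2 - 1/(6d) lies in [1/3, 1/2), and L - R = (d + 1/3)π ≥ 4π/3 > 4. -/
theorem admissible_radiusR {d : ℕ} (hd : 1 ≤ d) : Admissible (radiusR d) (2 * d * Real.pi) := by
  have hd' : (1 : ℝ) ≤ d := by exact_mod_cast hd
  have hπ := Real.pi_gt_three
  constructor <;> (try simp only [radiusR]) <;> nlinarith

theorem isClosed_squareE (d : ℕ) : IsClosed (squareE d) :=
  (isClosed_le (continuous_abs.comp continuous_re) continuous_const).inter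
    (isClosed_le (continuous_abs.comp continuous_im) continuous_const)

theorem interior_squareE_subset {d : ℕ} {z : ℂ} (hz : z ∈ interior (squareE d)) :
    |z.re| < 2 * d * Real.pi := by
  obtain ⟨ε, hε, hb⟩ := Metric.isOpen_iff.1 isOpen_interior z hz
  have key : ∀ s : ℝ, |s| = ε / 2 → |z.re + s| ≤ 2 * d * Real.pi := by
    intro s hs
    have : z + (s : ℂ) ∈ Metric.ball z ε := by
      rw [Metric.mem_ball, dist_eq_norm, add_sub_cancel_left, norm_real, Real.norm_eq_abs, hs]
      linarith
    have := (interior_subset (hb this)).1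
    simpa using this
  have h1 := abs_le.1 (key (ε / 2) (abs_of_pos (by linarith)))
  have h2 := abs_le.1 (key (-(ε / 2)) (by rw [abs_neg, abs_of_pos (by linarith)]))
  rw [abs_lt]; constructor <;> linarith [h1.2, h2.1]

theorem frontier_squareE_subset {d : ℕ} {z : ℂ} (hz : z ∈ frontier (squareE d)) :
    |z.im| ≤ 2 * d * Real.pi ∧ (|z.re| = 2 * d * Real.pi ∨ |z.im| = 2 * d * Real.pi) := by
  rw [(isClosed_squareE d).frontier_eq] at hz
  refine ⟨hz.1.2, ?_⟩
  by_contra! hne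
  refine hz.2 (mem_interior.2 ⟨{w : ℂ | |w.re| < 2 * d * Real.pi ∧ |w.im| < 2 * d * Real.pi},
    fun w hw => ⟨le_of_lt hw.1, le_of_lt hw.2⟩, ?_,
    ⟨lt_of_le_of_ne hz.1.1 hne.1, lt_of_le_of_ne hz.1.2 hne.2⟩⟩)
  exact (isOpen_lt (continuous_abs.comp continuous_re) continuous_const).inter
    (isOpen_lt (continuous_abs.comp continuous_im) continuous_const)

theorem lemma3p2 :
    ∃ K₁ : ℝ, 1 ≤ K₁ ∧ ∀ d : ℕ, 1 ≤ d →
      ∃ G : ℂ → ℂ,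
        ContinuousOn G (squareE d) ∧
        IsQuasiregularOn K₁ G (interior (squareE d)) ∧
        MapsTo G (squareE d) (closure (ellipseE (2 * d * Real.pi))) ∧
        {z | z ∈ squareE d ∧ beltramiCoeff G z ≠ 0} ⊆ squareE d \ discD d ∧
        (∀ z ∈ squareE d, G (-z) = G z) ∧
        (∀ z ∈ squareE d, G (starRingEnd ℂ z) = starRingEnd ℂ (G z)) ∧
        (∀ z ∈ frontier (squareE d) ∪ ((squareE d ∩ {w | w.re = 0}) \ discD d),
          G z = 2 * Complex.cosh z) ∧
        (∀ z ∈ closure (discD d), G z = (z / (radiusR d : ℂ)) ^ (2 * d)) := by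
  have hC := eight_le_interpDistortion
  refine ⟨interpDistortion, by linarith, fun d hd => ?_⟩
  have h := admissible_radiusR hd
  have hR : radiusR d = d * Real.pi - Real.pi / 3 := by unfold radiusR; ring
  have hlip := locallyLipschitz_interpMap h hR
  refine ⟨interpMap (radiusR d) (2 * d * Real.pi) (2 * d), hlip.continuous.continuousOn,
    isQuasiregularOn_of_locallyLipschitz (by linarith) isOpen_interior hlip ?_,
    fun z hz => closedEllipse_subset_closure _ (interpMap_mem_closedEllipse h d hz.1), ?_,
    fun z _ => interpMap_neg _ z, fun z _ => interpMap_conj h d z, ?_, ?_⟩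
  · filter_upwards [ae_hasDistortionAt_interpMap h d] with z hz hzU
    exact hz (interior_squareE_subset hzU)
  · rintro z ⟨hz, hμ⟩
    refine ⟨hz, fun hD => hμ ?_⟩
    obtain ⟨a, ha⟩ := hasDerivAt_interpMap (L := 2 * d * Real.pi) d
      (mem_ball_zero_iff.1 hD : ‖z‖ < radiusR d)
    exact beltramiCoeff_eq_zero_of_hasDerivAt ha
  · rintro z (hz | ⟨⟨_, hre⟩, hD⟩)
    · obtain ⟨hy, hb⟩ := frontier_squareE_subset hz
      exact interpMap_of_boundary h hR hy hb
    · refine interpMap_of_imaginary h hR hre (not_lt.1 fun hlt => hD ?_)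
      exact mem_ball_zero_iff.2 hlt
  · intro z hz
    refine interpMap_of_norm_le d ?_
    rw [discD, closure_ball _ h.pos.ne'] at hz
    exact mem_closedBall_zero_iff.1 hz

end
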